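/- Let $f_1,\dots,f_n:\mathbb R^d\to\mathbb R$ ($n\ge1$) be differentiable with $\|\nabla f_i(x)-\nabla f_i(y)\|\le L\|x-y\|$ for all $x,y$, where $L>0$, and put $f=\frac1n\sum_{i=1}^n f_i$. Let $h:\mathbb R^d\to(-\infty,+\infty]$ be convex and proximable, i.e. for every $x\in\mathbb R^d$ and $s>0$ the function $y\mapsto h(y)+\frac1{2s}\|y-x\|^2$ has a minimizer, denoted $\mathrm{prox}_{sh}(x)$ (unique when $h\not\equiv+\infty$). Let $F=f+h$ attain its minimum, let $x_0\in\mathbb R^d$ with $F(x_0)<+\infty$, and write $\Delta_0=F(x_0)-\min F$. *Algorithm.* Let $m,b,\ell$ be positive integers with $\ell\le d$, let $\gamma>0$, $\beta_\tau>0$ for $\tau\ge 0$, and let $e_1,\dots,e_d$ be the canonical basis. Put $g(x,\beta)=\sum_{j=1}^d\frac{f(x+\beta e_j)-f(x)}{\beta}e_j$ and, for $G\in O(d)$, $\hat g_i(x,G,\beta)=\frac d\ell\sum_{j=1}^{\ell}\frac{f_i(x+\beta Ge_j)-f_i(x)}{\beta}Ge_j$. Start from $x_0^0=x_0$. For $\tau=0,1,\dots$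 and $k=0,\dots,m-1$ draw indices $i_{j,k}^\tau$ uniformly from $\{1,\dots,n\}$ and matrices $G_{j,k}^\tau$ from the normalized Haar measure on $O(d)$, $1\le j\le b$, all independent, and set $$v_k^\tau=\frac1b\sum_{j=1}^b\big(\hat g_{i_{j,k}^\tau}(x_k^\tau,G_{j,k}^\tau,\beta_\tau)-\hat g_{i_{j,k}^\tau}(x_0^\tau,G_{j,k}^\tau,\beta_\tau)\big)+g(x_0^\tau,\beta_\tau),\qquad x_{k+1}^\tau=\mathrm{prox}_{\gamma h}(x_k^\tau-\gamma v_k^\tau),$$ and $x_0^{\tau+1}=x_m^\tau$. With input $T$, the algorithm runs the outer loop for $\tau=0,\dots,T$ and outputs $x_0^T$; its complexity is the number of evaluations of values $f_i(x)$ that it performs. *Assumptions.* Let $\mathcal G_\gamma(x)=\frac1\gamma\big(x-\mathrm{prox}_{\gamma h}(x-\gamma\nabla f(x))\big)$. Suppose that for some $\mu>0$ the revised Polyak–Łojasiewicz (RPL) inequality $\|\mathcal G_\gamma(x)\|^2\ge2\mu(F(x)-\min F)$ holds for every $x$ with $F(x)<+\infty$. Put $\alpha=1-\frac{\gamma\mu}2$,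 $\theta=1-\frac{\mu\gamma}2-\mu\gamma m$ and $$\bar C=\frac2\mu\Big[\frac{3L^2d^2}{\ell}+\frac{L^2d}{2}\Big],$$ and suppose $$\gamma<\min\Big\{\frac1{4L},\ \frac2\mu\,\frac1{2m+1},\ \frac{\sqrt{b\theta}}{10mL}\sqrt{\frac\ell d}\Big\}.$$ *Conclusions.* In each of the following bounds $F$ is almost surely finite at the iterate and the expectation exists. (i) If $\beta_\tau=\alpha^{m(\tau+1)/2}\eta_\tau$ with $\eta_\tau>0$ and $\sum_{i=0}^\infty\eta_i^2\le\tilde C<+\infty$, then for every $\tau\ge0$ $$\mathbb E[F(x_0^{\tau+1})-\min F]\le\alpha^{m(\tau+1)}\Big(\Delta_0+\frac2\mu\Big[\frac{3L^2d^2}{\ell}+\frac{L^2d}{2}\Big]\tilde C\Big).$$ (ii) If $\beta_\tau=\beta>0$ for all $\tau$, then for every $\tau\ge0$ $$\mathbb E[F(x_0^{\tau+1})-\min F]\le\alpha^{m(\tau+1)}\Delta_0+\bar C\beta^2.$$ (iii) For every $\varepsilon_0\in(0,1)$ there are constants $K,K'>0$ that depend only on $\varepsilon_0$ and $\Delta_0$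 (not on $\varepsilon,n,d,b,\ell,m,\gamma,\mu,L$ nor otherwise on the functions) such that for every $\varepsilon\in(0,\varepsilon_0]$, with $\beta_\tau=\sqrt{\varepsilon/(2\bar C)}$ for all $\tau$: every integer $T\ge K\,\frac1{m\gamma\mu}\log\frac1\varepsilon$ satisfies $$\mathbb E[F(x_0^T)-\min F]\le\varepsilon,$$ and for the smallest such integer $T=\big\lceil K\frac1{m\gamma\mu}\log\frac1\varepsilon\big\rceil$ the algorithm performs at most $$K'\Big(\frac{nd}{\gamma\mu m}+\frac{b\ell}{\gamma\mu}\Big)\log\frac1\varepsilon$$ evaluations of functions $f_i$. -/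

import Mathlib

open MeasureTheory ProbabilityTheory

noncomputable section

namespace VRSZD

/-- The Euclidean space `ℝ^d`. -/
abbrev E (d : ℕ) : Type := EuclideanSpace ℝ (Fin d)

/-- The orthogonal group `O(d)`. -/
abbrev OGroup (d : ℕ) : Type := Matrix.orthogonalGroup (Fin d) ℝ

instance (d : ℕ) : MeasurableSpace (OGroup d) := borel _

instance (d : ℕ) : BorelSpace (OGroup d) := ⟨rfl⟩

/-- The `j`-th vector of the canonical basis. -/
def basisVec {d : ℕ} (j : Fin d) : E d := EuclideanSpace.single j 1

/-- The image `G e_j` of the `j`-th canonical basis vector under an orthogonal matrix `G`. -/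
def dirVec {d : ℕ} (G : OGroup d) (j : Fin d) : E d :=
  WithLp.toLp 2 ((G : Matrix (Fin d) (Fin d) ℝ).mulVec (basisVec j).ofLp)

section Problem

variable {d n : ℕ}

/-- The finite sum `f = (1/n) ∑ i, f_i`. -/
def avg (f : Fin n → E d → ℝ) (x : E d) : ℝ := (1 / (n : ℝ)) * ∑ i, f i x

/-- The objective `F = f + h`; the regularizer `h`, hence `F`, may take the value `+∞`. -/
def objective (f : Fin n → E d → ℝ) (h : E d → EReal) (x : E d) : EReal :=
  ((avg f x : ℝ) : EReal) + h x

/-- `min F` as a real number: the infimum in the complete lattice `EReal`, used only when it is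
attained and finite. -/
def minValue (f : Fin n → E d → ℝ) (h : E d → EReal) : ℝ := (⨅ x, objective f h x).toReal

/-- The optimality gap `F(x) - min F`, used only at points where `F` is finite. -/
def gap (f : Fin n → E d → ℝ) (h : E d → EReal) (x : E d) : ℝ :=
  (objective f h x).toReal - minValue f h

/-- `L`-smoothness of each `f_i`. -/
def IsSmoothFamily (f : Fin n → E d → ℝ) (L : ℝ) : Prop :=
  ∀ i, Differentiable ℝ (f i) ∧ ∀ x y, ‖gradient (f i) x - gradient (f i) y‖ ≤ L * ‖x - y‖

/-- A convex function with values in `(-∞, +∞]`: it is convex on its effective domain, which is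
a convex set. -/
def IsConvexExt (h : E d → EReal) : Prop :=
  (∀ x, h x ≠ ⊥) ∧ ConvexOn ℝ {x | h x ≠ ⊤} (fun x => (h x).toReal)

/-- `p` minimizes `y ↦ h y + ‖y - x‖² / (2γ)`. -/
def IsProx (h : E d → EReal) (γ : ℝ) (x p : E d) : Prop :=
  ∀ y, h p + ((1 / (2 * γ) * ‖p - x‖ ^ 2 : ℝ) : EReal)
    ≤ h y + ((1 / (2 * γ) * ‖y - x‖ ^ 2 : ℝ) : EReal)

/-- The minimization problems that define the proximal operators of `h` have solutions. -/
def IsProximable (h : E d → EReal) : Prop :=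
  ∀ γ : ℝ, 0 < γ → ∀ x, ∃ p, IsProx h γ x p

/-- The proximal operator `prox_{γ h}`. For proximable, convex, proper `h` and `γ > 0` the
minimizer is unique, so that nothing is chosen. -/
def prox (h : E d → EReal) (γ : ℝ) (x : E d) : E d := Classical.epsilon (IsProx h γ x)

/-- The gradient mapping `(1/γ) (x - prox_{γ h} (x - γ ∇f(x)))`. -/
def gradMap (f : Fin n → E d → ℝ) (h : E d → EReal) (γ : ℝ) (x : E d) : E d :=
  (1 / γ) • (x - prox h γ (x - γ • gradient (avg f) x))

/-- The revised Polyak–Łojasiewicz condition with constant `μ` and stepsize `γ`, required at the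
points where `F` is finite. -/
def IsRPL (f : Fin n → E d → ℝ) (h : E d → EReal) (γ μ : ℝ) : Prop :=
  ∀ x, objective f h x ≠ ⊤ → 2 * μ * gap f h x ≤ ‖gradMap f h γ x‖ ^ 2

end Problem

section Algorithm

variable {d n b : ℕ}

/-- Forward finite differences of `f` along the canonical basis. -/
def fullApprox (f : Fin n → E d → ℝ) (β : ℝ) (x : E d) : E d :=
  ∑ j : Fin d, ((avg f (x + β • basisVec j) - avg f x) / β) • basisVec j

/-- Forward finite differences of `f_i` along the first `ℓ` columns of `G`, scaled by `d/ℓ`. -/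
def stochApprox (f : Fin n → E d → ℝ) (ℓ : ℕ) (β : ℝ) (i : Fin n) (G : OGroup d) (x : E d) :
    E d :=
  ((d : ℝ) / ℓ) • ∑ j : Fin d with j.val < ℓ,
    ((f i (x + β • dirVec G j) - f i x) / β) • dirVec G j

/-- The search direction at the inner iterate `x`, with outer iterate `x₀`, discretization `β`
and sampled batch `ξ` of indices and orthogonal matrices. -/
def searchDir (f : Fin n → E d → ℝ) (ℓ : ℕ) (β : ℝ) (ξ : Fin b → Fin n × OGroup d)
    (x₀ x : E d) : E d :=
  (1 / (b : ℝ)) • ∑ j : Fin b, (stochApprox f ℓ β (ξ j).1 (ξ j).2 x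
      - stochApprox f ℓ β (ξ j).1 (ξ j).2 x₀)
    + fullApprox f β x₀

/-- The inner iterates `x_k` started at the outer iterate `x₀`; the batch of step `k` is `ξ k`. -/
def innerIter (f : Fin n → E d → ℝ) (h : E d → EReal) (γ : ℝ) (ℓ : ℕ) (β : ℝ)
    (ξ : ℕ → Fin b → Fin n × OGroup d) (x₀ : E d) : ℕ → E d
  | 0 => x₀
  | k + 1 => prox h γ (innerIter f h γ ℓ β ξ x₀ k
      - γ • searchDir f ℓ β (ξ k) x₀ (innerIter f h γ ℓ β ξ x₀ k))

/-- The outer iterates `x_0^τ`; `ξ τ k` is the batch of inner step `k` of outer iteration `τ`. -/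
def outerIter (f : Fin n → E d → ℝ) (h : E d → EReal) (γ : ℝ) (ℓ m : ℕ) (β : ℕ → ℝ)
    (ξ : ℕ → ℕ → Fin b → Fin n × OGroup d) (x₀ : E d) : ℕ → E d
  | 0 => x₀
  | τ + 1 => innerIter f h γ ℓ (β τ) (ξ τ) (outerIter f h γ ℓ m β ξ x₀ τ) m

end Algorithm

section Sampling

variable {d n b : ℕ} {Ω : Type*} [MeasurableSpace Ω]

/-- The random variables drawn by the algorithm: indices uniform on `{1, …, n}` and matrices
uniform on `O(d)` (distributed according to the normalized Haar measure), all independent. -/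
structure IsSampling (P : Measure Ω) (I : ℕ → ℕ → Fin b → Ω → Fin n)
    (G : ℕ → ℕ → Fin b → Ω → OGroup d) : Prop where
  measurable_index : ∀ τ k j, Measurable (I τ k j)
  measurable_matrix : ∀ τ k j, Measurable (G τ k j)
  uniform_index : ∀ τ k j i, P {ω | I τ k j ω = i} = (n : ENNReal)⁻¹
  haar_matrix : ∀ τ k j, (P.map (G τ k j)).IsHaarMeasure
  indep_index_matrix : ∀ τ k j, IndepFun (I τ k j) (G τ k j) P
  indep_draws : iIndepFun
    (fun (s : ℕ × ℕ × Fin b) (ω : Ω) => (I s.1 s.2.1 s.2.2 ω, G s.1 s.2.1 s.2.2 ω)) P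

/-- The realization of all draws at the outcome `ω`. -/
def draws (I : ℕ → ℕ → Fin b → Ω → Fin n) (G : ℕ → ℕ → Fin b → Ω → OGroup d) (ω : Ω) :
    ℕ → ℕ → Fin b → Fin n × OGroup d :=
  fun τ k j => (I τ k j ω, G τ k j ω)

/-- `𝔼[F(X) - min F] ≤ B`, including that `F(X)` is almost surely finite and that the
expectation exists. -/
def ExpectedGapLE (P : Measure Ω) (f : Fin n → E d → ℝ) (h : E d → EReal) (X : Ω → E d)
    (B : ℝ) : Prop :=
  (∀ᵐ ω ∂P, objective f h (X ω) ≠ ⊤) ∧ Integrable (fun ω => gap f h (X ω)) P ∧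
    ∫ ω, gap f h (X ω) ∂P ≤ B

end Sampling

/-! The cost model: a program has no access to the functions `f_i` other than by queries
"evaluate `f_i` at `x`", and its cost is the number of queries. -/

/-- Programs that may query values `f_i(x)` and return an element of `α`. -/
inductive Prog (n d : ℕ) (α : Type) : Type
  | ret : α → Prog n d α
  | query : Fin n → E d → (ℝ → Prog n d α) → Prog n d α

namespace Prog

variable {n d b : ℕ} {α β : Type}

/-- Sequential composition. -/
def andThen : Prog n d α → (α → Prog n d β) → Prog n d β
  | ret a, q => q a
  | query i x k, q => query i x fun r => andThen (k r) q

instance : Monad (Prog n d) where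
  pure := ret
  bind := andThen

/-- The value returned when queries are answered by the functions `f_i`. -/
def run (f : Fin n → E d → ℝ) : Prog n d α → α
  | ret a => a
  | query i x k => run f (k (f i x))

/-- The number of function evaluations performed. -/
def evals (f : Fin n → E d → ℝ) : Prog n d α → ℕ
  | ret _ => 0
  | query i x k => evals f (k (f i x)) + 1

/-- A single function evaluation `f_i(x)`. -/
def eval (i : Fin n) (x : E d) : Prog n d ℝ := query i x ret

/-- Run a program for each entry of a list and add up the results. -/
def sumOver {ι : Type} [AddMonoid α] : List ι → (ι → Prog n d α) → Prog n d α
  | [], _ => ret 0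
  | a :: l, p => do
      let u ← p a
      let w ← sumOver l p
      return u + w

/-- Evaluate the full finite sum `f(x)`. -/
def evalAvg (x : E d) : Prog n d ℝ := do
  let s ← sumOver (List.finRange n) fun i => eval i x
  return (1 / (n : ℝ)) * s

/-- The full surrogate of the gradient. -/
def fullApprox (β : ℝ) (x : E d) : Prog n d (E d) := do
  let c ← evalAvg x
  sumOver (List.finRange d) fun j => do
    let v ← evalAvg (x + β • basisVec j)
    return ((v - c) / β) • basisVec j

/-- The structured stochastic surrogate of the gradient. -/
def stochApprox (ℓ : ℕ) (β : ℝ) (i : Fin n) (G : OGroup d) (x : E d) : Prog n d (E d) := do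
  let c ← eval i x
  let s ← sumOver ((List.finRange d).filter fun j => j.val < ℓ) fun j => do
    let v ← eval i (x + β • dirVec G j)
    return ((v - c) / β) • dirVec G j
  return ((d : ℝ) / ℓ) • s

/-- The first `k` inner steps from `x₀`, with full surrogate `g`. -/
def inner (h : E d → EReal) (γ : ℝ) (ℓ : ℕ) (β : ℝ) (ξ : ℕ → Fin b → Fin n × OGroup d)
    (g x₀ : E d) : ℕ → Prog n d (E d)
  | 0 => return x₀
  | k + 1 => do
      let x ← inner h γ ℓ β ξ g x₀ k
      let s ← sumOver (List.finRange b) fun j => do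
        let u ← stochApprox ℓ β (ξ k j).1 (ξ k j).2 x
        let w ← stochApprox ℓ β (ξ k j).1 (ξ k j).2 x₀
        return u - w
      return prox h γ (x - γ • ((1 / (b : ℝ)) • s + g))

/-- One outer iteration. -/
def outerStep (h : E d → EReal) (γ : ℝ) (ℓ m : ℕ) (β : ℝ) (ξ : ℕ → Fin b → Fin n × OGroup d)
    (x₀ : E d) : Prog n d (E d) := do
  let g ← fullApprox β x₀
  inner h γ ℓ β ξ g x₀ m

/-- The first `τ` outer iterations. -/
def outer (h : E d → EReal) (γ : ℝ) (ℓ m : ℕ) (β : ℕ → ℝ)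
    (ξ : ℕ → ℕ → Fin b → Fin n × OGroup d) (x₀ : E d) : ℕ → Prog n d (E d)
  | 0 => return x₀
  | τ + 1 => do
      let x ← outer h γ ℓ m β ξ x₀ τ
      outerStep h γ ℓ m (β τ) (ξ τ) x

/-- The whole algorithm: the outer loop runs over `τ = 0, …, T`, and `x_0^T` is returned. -/
def vrszd (h : E d → EReal) (γ : ℝ) (ℓ m : ℕ) (β : ℕ → ℝ)
    (ξ : ℕ → ℕ → Fin b → Fin n × OGroup d) (x₀ : E d) (T : ℕ) : Prog n d (E d) := do
  let x ← outer h γ ℓ m β ξ x₀ T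
  let _ ← outerStep h γ ℓ m (β T) (ξ T) x
  return x

theorem run_bind (f : Fin n → E d → ℝ) (p : Prog n d α) (q : α → Prog n d β) :
    (p >>= q).run f = (q (p.run f)).run f := by
  change (andThen p q).run f = _
  induction p with
  | ret a => rfl
  | query i x k ih => exact ih _

theorem run_pure (f : Fin n → E d → ℝ) (a : α) : (pure a : Prog n d α).run f = a := rfl

theorem run_sumOver {ι : Type} [AddMonoid α] (f : Fin n → E d → ℝ) (l : List ι)
    (p : ι → Prog n d α) : (sumOver l p).run f = (l.map fun a => (p a).run f).sum := by
  induction l with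
  | nil => rfl
  | cons a l ih => simp [sumOver, run_bind, run_pure, ih]

theorem run_evalAvg (f : Fin n → E d → ℝ) (x : E d) : (evalAvg x).run f = avg f x := by
  simp [evalAvg, run_bind, run_pure, run_sumOver, avg, eval, run, List.sum_ofFn,
    ← List.ofFn_eq_map]

theorem run_fullApprox (f : Fin n → E d → ℝ) (β : ℝ) (x : E d) :
    (fullApprox β x).run f = VRSZD.fullApprox f β x := by
  simp [fullApprox, run_bind, run_pure, run_sumOver, run_evalAvg, VRSZD.fullApprox,
    List.sum_ofFn, ← List.ofFn_eq_map]

theorem run_stochApprox (f : Fin n → E d → ℝ) (ℓ : ℕ) (β : ℝ) (i : Fin n) (G : OGroup d)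
    (x : E d) : (stochApprox ℓ β i G x).run f = VRSZD.stochApprox f ℓ β i G x := by
  simp only [stochApprox, run_bind, run_pure, run_sumOver, eval, run, VRSZD.stochApprox]
  congr 1

theorem run_inner (f : Fin n → E d → ℝ) (h : E d → EReal) (γ : ℝ) (ℓ : ℕ) (β : ℝ)
    (ξ : ℕ → Fin b → Fin n × OGroup d) (x₀ : E d) (k : ℕ) :
    (inner h γ ℓ β ξ (VRSZD.fullApprox f β x₀) x₀ k).run f = innerIter f h γ ℓ β ξ x₀ k := by
  induction k with
  | zero => rfl
  | succ k ih =>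
    simp [inner, run_bind, run_pure, run_sumOver, run_stochApprox, ih, innerIter, searchDir,
      List.sum_ofFn, ← List.ofFn_eq_map]

theorem run_outer (f : Fin n → E d → ℝ) (h : E d → EReal) (γ : ℝ) (ℓ m : ℕ) (β : ℕ → ℝ)
    (ξ : ℕ → ℕ → Fin b → Fin n × OGroup d) (x₀ : E d) (τ : ℕ) :
    (outer h γ ℓ m β ξ x₀ τ).run f = outerIter f h γ ℓ m β ξ x₀ τ := by
  induction τ with
  | zero => rfl
  | succ τ ih =>
    simp [outer, outerStep, run_bind, ih, run_fullApprox, run_inner, outerIter]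

/-- The program returns the outer iterate `x_0^T`. -/
theorem run_vrszd (f : Fin n → E d → ℝ) (h : E d → EReal) (γ : ℝ) (ℓ m : ℕ) (β : ℕ → ℝ)
    (ξ : ℕ → ℕ → Fin b → Fin n × OGroup d) (x₀ : E d) (T : ℕ) :
    (vrszd h γ ℓ m β ξ x₀ T).run f = outerIter f h γ ℓ m β ξ x₀ T := by
  simp [vrszd, run_bind, run_pure, run_outer]

end Prog

/-- The contraction factor `α = 1 - γ μ / 2`. -/
def rate (γ μ : ℝ) : ℝ := 1 - γ * μ / 2

/-- The quantity `θ = 1 - μ γ / 2 - μ γ m`. -/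
def theta (γ μ : ℝ) (m : ℕ) : ℝ := 1 - μ * γ / 2 - μ * γ * m

/-- The constant `(2/μ) (3 L² d² / ℓ + L² d / 2)`. -/
def errConst (L μ : ℝ) (d ℓ : ℕ) : ℝ :=
  2 / μ * (3 * L ^ 2 * (d : ℝ) ^ 2 / ℓ + L ^ 2 * d / 2)

end VRSZD

end

/-! Each proximal step contracts the gap by `α = rate γ μ`, up to the squared error of the search
direction, and it also leaves a negative multiple of the squared step length (`gap_step_le`). This
follows from the three-point inequality `gap_prox_le`, used once for the exact gradient step, where
RPL turns its length into a decrease of the gap, and once to compare the actual step with the exact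
one.

The error of the direction has two sources. Finite differences contribute a deterministic term of
order `β ^ 2`. The rest is the fluctuation of a batch of rescaled random projections of `∇f_i(x_k) -
∇f_i(x_0)`. By invariance of the Haar measure these are unbiased with second moment `d / ℓ` times
the squared norm, so the conditional variance is at most `(d L² / (b ℓ)) ‖x_k - x_0‖²`. The batch is
independent of the past, so this bound can be integrated over the iterates.

By Cauchy–Schwarz `‖x_k - x_0‖²` is at most `k` times the sum of the squared step lengths so far,
and the negative terms pay for it: the batch condition on `γ` and Bernoulli's inequality `θ ≤ α ^ m`
give exactly what `le_of_inner_recursion` needs. Only the discretization term survives. Its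
geometric sum yields `E gap_{τ+1} ≤ α ^ m E gap_τ + (1 - α ^ m) C β_τ²` with `C = errConst L μ d ℓ`
(`integral_gap_outerIter_succ_le`). Unrolling this gives (i) and (ii). For (iii), `β` and `T` each
account for `ε / 2`, and the evaluations are counted exactly.

Integrability costs nothing: at each fixed step the iterates and their gaps are bounded uniformly
over all outcomes (`IsRegular`). -/

namespace VRSZD

/-! ### Smooth functions -/

/-- The quadratic Taylor bound for a function with Lipschitz gradient. -/
theorem abs_sub_sub_inner_gradient_le {V : Type*} [NormedAddCommGroup V] [InnerProductSpace ℝ V]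
    [CompleteSpace V] {f : V → ℝ} {L : ℝ} (hf : Differentiable ℝ f)
    (hL : ∀ x y, ‖gradient f x - gradient f y‖ ≤ L * ‖x - y‖) (x y : V) :
    |f y - f x - inner ℝ (gradient f x) (y - x)| ≤ L / 2 * ‖y - x‖ ^ 2 := by
  set u := y - x with hu
  -- The Taylor remainder along the segment vanishes at `0`, and its derivative is dominated by that
  -- of `L / 2 * ‖u‖ ^ 2 * t ^ 2`.
  let φ : ℝ → ℝ := fun t => f (x + t • u) - f x - t * inner ℝ (gradient f x) u
  have hline : ∀ t : ℝ, HasDerivAt (fun t : ℝ => x + t • u) u t := fun t => by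
    simpa using ((hasDerivAt_id t).smul_const u).const_add x
  have hφ : ∀ t, HasDerivAt φ (inner ℝ (gradient f (x + t • u) - gradient f x) u) t := fun t => by
    have h1 := ((hf (x + t • u)).hasGradientAt.hasFDerivAt.comp_hasDerivAt t (hline t))
    have h2 := (h1.sub_const (f x)).sub ((hasDerivAt_id t).mul_const (inner ℝ (gradient f x) u))
    rw [inner_sub_left]
    refine HasDerivAt.congr_deriv h2 ?_
    simp
  have hB : ∀ t : ℝ, HasDerivAt (fun t : ℝ => L / 2 * ‖u‖ ^ 2 * t ^ 2) (L * ‖u‖ ^ 2 * t) t :=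
    fun t => by
      refine ((hasDerivAt_pow 2 t).const_mul (L / 2 * ‖u‖ ^ 2)).congr_deriv ?_
      push_cast; ring
  have key := image_norm_le_of_norm_deriv_right_le_deriv_boundary (f := φ) (a := 0) (b := 1)
    (fun t _ => (hφ t).continuousAt.continuousWithinAt)
    (fun t _ => (hφ t).hasDerivWithinAt) (by simp [φ]) hB
    (fun t ht => by
      calc ‖inner ℝ (gradient f (x + t • u) - gradient f x) u‖
          ≤ ‖gradient f (x + t • u) - gradient f x‖ * ‖u‖ := norm_inner_le_norm _ _
        _ ≤ L * ‖x + t • u - x‖ * ‖u‖ := by gcongr; exact hL _ _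
        _ = L * ‖u‖ ^ 2 * t := by
          rw [add_sub_cancel_left, norm_smul, Real.norm_of_nonneg ht.1]; ring)
    (Set.right_mem_Icc.2 zero_le_one)
  simpa [φ, hu] using key

variable {d n : ℕ}

theorem hasGradientAt_avg {f : Fin n → E d → ℝ} (hf : ∀ i, Differentiable ℝ (f i)) (x : E d) :
    HasGradientAt (avg f) ((1 / (n : ℝ)) • ∑ i, gradient (f i) x) x := by
  rw [hasGradientAt_iff_hasFDerivAt]
  have h1 := (HasFDerivAt.fun_sum (u := Finset.univ) fun i _ =>
    (hf i x).hasGradientAt.hasFDerivAt).const_mul (1 / (n : ℝ))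
  refine HasFDerivAt.congr_fderiv h1 ?_
  rw [map_smulₛₗ, map_sum]; rfl

theorem gradient_avg {f : Fin n → E d → ℝ} (hf : ∀ i, Differentiable ℝ (f i)) (x : E d) :
    gradient (avg f) x = (1 / (n : ℝ)) • ∑ i, gradient (f i) x :=
  (hasGradientAt_avg hf x).gradient

theorem norm_avg_le {V : Type*} [SeminormedAddCommGroup V] [NormedSpace ℝ V] (hn : 0 < n)
    {w : Fin n → V} {c : ℝ} (hw : ∀ i, ‖w i‖ ≤ c) : ‖(1 / (n : ℝ)) • ∑ i, w i‖ ≤ c := by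
  have hn' : (0 : ℝ) < n := by exact_mod_cast hn
  rw [norm_smul, Real.norm_of_nonneg (by positivity)]
  calc 1 / (n : ℝ) * ‖∑ i, w i‖ ≤ 1 / (n : ℝ) * ∑ _i : Fin n, c := by
        gcongr; exact norm_sum_le_of_le _ fun i _ => hw i
    _ = c := by simp; field_simp

theorem IsSmoothFamily.differentiable_avg {f : Fin n → E d → ℝ} {L : ℝ}
    (hf : IsSmoothFamily f L) : Differentiable ℝ (avg f) := fun x =>
  (hasGradientAt_avg (fun i => (hf i).1) x).differentiableAt

theorem IsSmoothFamily.norm_gradient_avg_sub_le {f : Fin n → E d → ℝ} {L : ℝ} (hn : 0 < n)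
    (hf : IsSmoothFamily f L) (x y : E d) :
    ‖gradient (avg f) x - gradient (avg f) y‖ ≤ L * ‖x - y‖ := by
  rw [gradient_avg fun i => (hf i).1, gradient_avg fun i => (hf i).1, ← smul_sub,
    ← Finset.sum_sub_distrib]
  exact norm_avg_le hn fun i => (hf i).2 x y

theorem IsSmoothFamily.abs_avg_le {f : Fin n → E d → ℝ} {L : ℝ} (hn : 0 < n)
    (hf : IsSmoothFamily f L) (x y : E d) :
    |avg f y - avg f x - inner ℝ (gradient (avg f) x) (y - x)| ≤ L / 2 * ‖y - x‖ ^ 2 :=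
  abs_sub_sub_inner_gradient_le hf.differentiable_avg (hf.norm_gradient_avg_sub_le hn) x y

theorem IsSmoothFamily.continuous_gradient_avg {f : Fin n → E d → ℝ} {L : ℝ} (hn : 0 < n)
    (hL : 0 < L) (hf : IsSmoothFamily f L) : Continuous (gradient (avg f)) :=
  (LipschitzWith.of_dist_le_mul (K := ⟨L, hL.le⟩) fun x y => by
    rw [dist_eq_norm, dist_eq_norm]; exact hf.norm_gradient_avg_sub_le hn x y).continuous

/-! ### The proximal operator -/

section Prox

variable {h : E d → EReal} {γ : ℝ}

theorem IsProx.ne_top {x p z : E d} (hp : IsProx h γ x p) (hz : h z ≠ ⊤) : h p ≠ ⊤ := by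
  intro htop
  have := hp z
  rw [htop, EReal.top_add_coe, top_le_iff] at this
  exact EReal.add_ne_top hz (EReal.coe_ne_top _) this

theorem IsProx.toReal_le {x p y : E d} (hbot : ∀ x, h x ≠ ⊥) (hp : IsProx h γ x p)
    (hy : h y ≠ ⊤) :
    (h p).toReal + 1 / (2 * γ) * ‖p - x‖ ^ 2 ≤ (h y).toReal + 1 / (2 * γ) * ‖y - x‖ ^ 2 := by
  have := hp y
  rw [← EReal.coe_toReal (hp.ne_top hy) (hbot p), ← EReal.coe_toReal hy (hbot y)] at this
  exact_mod_cast this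

/-- The variational inequality that characterizes the proximal point. -/
theorem IsProx.variational {x p y : E d} (hconv : IsConvexExt h) (hγ : 0 < γ)
    (hp : IsProx h γ x p) (hy : h y ≠ ⊤) :
    (h p).toReal + 1 / γ * inner ℝ (p - x) (p - y) ≤ (h y).toReal := by
  have hpt := hp.ne_top hy
  -- Compare `p` with the point `(1 - t) p + t y` of the segment, use convexity, and divide by `t`;
  -- the remaining error is linear in `t`.
  have key : ∀ t : ℝ, 0 < t → t ≤ 1 →
      (h p).toReal + 1 / γ * inner ℝ (p - x) (p - y)
        ≤ (h y).toReal + t * (1 / (2 * γ) * ‖y - p‖ ^ 2) := by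
    intro t ht ht1
    have hmem := hconv.2.1 hpt hy (sub_nonneg.2 ht1) ht.le (by ring)
    have hle := hconv.2.2 hpt hy (sub_nonneg.2 ht1) ht.le (by ring)
    have h1 := hp.toReal_le hconv.1 hmem
    have h2 : (1 - t) • p + t • y - x = (p - x) + t • (y - p) := by module
    rw [h2, norm_add_sq_real, norm_smul, inner_smul_right, Real.norm_of_nonneg ht.le] at h1
    have h3 : inner ℝ (p - x) (p - y) = - inner ℝ (p - x) (y - p) := by
      rw [← inner_neg_right, neg_sub]
    simp only [smul_eq_mul] at hle
    rw [h3]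
    have h4 : 0 ≤ t * ((h y).toReal + t * (1 / (2 * γ) * ‖y - p‖ ^ 2)
        - ((h p).toReal + 1 / γ * -inner ℝ (p - x) (y - p))) := by
      have : t * ((h y).toReal + t * (1 / (2 * γ) * ‖y - p‖ ^ 2)
        - ((h p).toReal + 1 / γ * -inner ℝ (p - x) (y - p)))
        = t * (h y).toReal - t * (h p).toReal + 1 / (2 * γ) * (2 * (t * inner ℝ (p - x) (y - p))
          + (t * ‖y - p‖) ^ 2) := by field_simp; ring
      rw [this]
      linarith
    have := nonneg_of_mul_nonneg_right h4 ht
    linarith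
  by_contra! hlt
  set δ := (h p).toReal + 1 / γ * inner ℝ (p - x) (p - y) - (h y).toReal with hδ
  set q := 1 / (2 * γ) * ‖y - p‖ ^ 2
  have hq : 0 ≤ q := by positivity
  have hδ0 : 0 < δ := by linarith
  -- This `t` makes the error `t * q` at most `δ / 2`; `q + 1` avoids dividing by zero when `y = p`.
  have h1 := key (min 1 (δ / (q + 1) / 2)) (by positivity) (min_le_left _ _)
  have h2 : min 1 (δ / (q + 1) / 2) * q ≤ δ / (q + 1) / 2 * q := by
    gcongr; exact min_le_right _ _
  have h3 : δ / (q + 1) / 2 * q ≤ δ / 2 := by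
    rw [div_div, div_mul_eq_mul_div, div_le_div_iff₀ (by positivity) (by positivity)]
    nlinarith
  linarith

theorem isProx_prox (hprox : IsProximable h) (hγ : 0 < γ) (x : E d) :
    IsProx h γ x (prox h γ x) :=
  Classical.epsilon_spec (hprox γ hγ x)

variable (hconv : IsConvexExt h) (hprox : IsProximable h) (hγ : 0 < γ)
  {z : E d} (hz : h z ≠ ⊤)

include hprox hγ hz

theorem prox_ne_top (x : E d) : h (prox h γ x) ≠ ⊤ := (isProx_prox hprox hγ x).ne_top hz

include hconv

/-- Adding the variational inequalities of the two proximal points, each tested at the other,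
cancels `h` and leaves `‖p - q‖² ≤ ⟨x - y, p - q⟩`. The finite point `z` ensures that `h` is finite
at both. -/
theorem norm_prox_sub_prox_le (x y : E d) : ‖prox h γ x - prox h γ y‖ ≤ ‖x - y‖ := by
  have hx := (isProx_prox hprox hγ x).variational hconv hγ (prox_ne_top hprox hγ hz y)
  have hy := (isProx_prox hprox hγ y).variational hconv hγ (prox_ne_top hprox hγ hz x)
  set p := prox h γ x
  set q := prox h γ y
  have h1 : 1 / γ * (inner ℝ (p - x) (p - q) + inner ℝ (q - y) (q - p)) ≤ 0 := by linarith
  have h2 : inner ℝ (p - x) (p - q) + inner ℝ (q - y) (q - p) ≤ 0 := by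
    by_contra! h3
    have := mul_pos (one_div_pos.2 hγ) h3
    linarith
  have h3 : inner ℝ (p - x) (p - q) + inner ℝ (q - y) (q - p)
      = ‖p - q‖ ^ 2 - inner ℝ (x - y) (p - q) := by
    rw [← real_inner_self_eq_norm_sq]
    simp only [inner_sub_left, inner_sub_right]; ring
  have h4 := real_inner_le_norm (x - y) (p - q)
  by_contra! h5
  nlinarith [norm_nonneg (x - y), norm_nonneg (p - q)]

theorem continuous_prox : Continuous (prox h γ) :=
  (LipschitzWith.of_dist_le_mul (K := 1) fun x y => by
    simpa [dist_eq_norm] using norm_prox_sub_prox_le hconv hprox hγ hz x y).continuous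

/-- The regularizer need not be measurable, but it is continuous along proximal points. -/
theorem continuous_toReal_prox : Continuous fun x => (h (prox h γ x)).toReal := by
  have hc := continuous_prox hconv hprox hγ hz
  -- A subgradient inequality at each of two proximal points squeezes the difference of values
  -- between inner products that vanish as the proximal points merge.
  have hle : ∀ x y, (h (prox h γ x)).toReal
      ≤ (h (prox h γ y)).toReal - 1 / γ * inner ℝ (prox h γ x - x) (prox h γ x - prox h γ y) :=
    fun x y => by
      have := (isProx_prox hprox hγ x).variational hconv hγ (prox_ne_top hprox hγ hz y)
      linarith
  rw [continuous_iff_continuousAt]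
  intro x
  refine tendsto_of_tendsto_of_tendsto_of_le_of_le
    (g := fun y => (h (prox h γ x)).toReal
      + 1 / γ * inner ℝ (prox h γ x - x) (prox h γ x - prox h γ y))
    (h := fun y => (h (prox h γ x)).toReal
      - 1 / γ * inner ℝ (prox h γ y - y) (prox h γ y - prox h γ x)) ?_ ?_
    (fun y => by have := hle x y; simp only; linarith) (fun y => hle y x)
  · refine Continuous.tendsto' (by fun_prop) _ _ (by simp)
  · refine Continuous.tendsto' (by fun_prop) _ _ (by simp)

end Prox

/-! ### One proximal step -/

section Step

variable {d n : ℕ} {f : Fin n → E d → ℝ} {h : E d → EReal} {γ μ L : ℝ}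

theorem objective_ne_top_iff {x : E d} : objective f h x ≠ ⊤ ↔ h x ≠ ⊤ := by
  refine ⟨fun hx hh => hx ?_, fun hx => EReal.add_ne_top (EReal.coe_ne_top _) hx⟩
  rw [objective, hh, EReal.coe_add_top]

theorem gap_eq {x : E d} (hconv : IsConvexExt h) (hx : h x ≠ ⊤) :
    gap f h x = avg f x + (h x).toReal - minValue f h := by
  rw [gap, objective, EReal.toReal_add (EReal.coe_ne_top _) (EReal.coe_ne_bot _) hx (hconv.1 x),
    EReal.toReal_coe]

theorem gap_nonneg {x z : E d} (hconv : IsConvexExt h)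
    (hz : ∀ x, objective f h z ≤ objective f h x) (hx : h x ≠ ⊤) : 0 ≤ gap f h x := by
  have hinf : ⨅ y, objective f h y = objective f h z :=
    le_antisymm (iInf_le _ _) (le_iInf hz)
  rw [gap, minValue, hinf, sub_nonneg]
  refine EReal.toReal_le_toReal (hz x) ?_ (objective_ne_top_iff.2 hx)
  rw [objective, Ne, EReal.add_eq_bot_iff]
  simp [hconv.1 z]

variable (hconv : IsConvexExt h) (hprox : IsProximable h) (hγ : 0 < γ) (hn : 0 < n)
  (hf : IsSmoothFamily f L)

include hconv hprox hγ hn hf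

/-- The three-point inequality for a proximal step along an arbitrary direction. -/
theorem gap_prox_le {x v z : E d} (hz : h z ≠ ⊤) :
    gap f h (prox h γ (x - γ • v)) ≤ gap f h z
      + inner ℝ (gradient (avg f) x - v) (prox h γ (x - γ • v) - z)
      + (L / 2 - 1 / (2 * γ)) * ‖prox h γ (x - γ • v) - x‖ ^ 2
      + (L / 2 + 1 / (2 * γ)) * ‖z - x‖ ^ 2
      - 1 / (2 * γ) * ‖prox h γ (x - γ • v) - z‖ ^ 2 := by
  have hvar := (isProx_prox hprox hγ (x - γ • v)).variational hconv hγ hz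
  have hp := prox_ne_top hprox hγ hz (x - γ • v)
  set p := prox h γ (x - γ • v)
  have h1 := (abs_le.1 (hf.abs_avg_le hn x p)).2
  have h2 := (abs_le.1 (hf.abs_avg_le hn x z)).1
  rw [gap_eq hconv hp, gap_eq hconv hz]
  have h3 : p - (x - γ • v) = (p - x) + γ • v := by abel
  -- Polarization turns the inner product of the variational inequality into the three squared
  -- distances.
  have h4 : ‖z - x‖ ^ 2 = ‖p - x‖ ^ 2 - 2 * inner ℝ (p - x) (p - z) + ‖p - z‖ ^ 2 := by
    rw [← norm_sub_sq_real]; congr 2; abel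
  have h5 : inner ℝ (gradient (avg f) x) (p - x) - inner ℝ (gradient (avg f) x) (z - x)
      = inner ℝ (gradient (avg f) x) (p - z) := by
    rw [← inner_sub_right]; congr 1; abel
  rw [h3, inner_add_left, real_inner_smul_left, mul_add, ← mul_assoc (1 / γ) γ,
    one_div_mul_cancel hγ.ne', one_mul] at hvar
  rw [inner_sub_left]
  have h6 : 1 / γ * inner ℝ (p - x) (p - z)
      = 1 / (2 * γ) * (‖p - x‖ ^ 2 + ‖p - z‖ ^ 2 - ‖z - x‖ ^ 2) := by
    rw [h4]; field_simp; ring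
  linarith

/-- One step of the inner loop: contraction of the gap up to the error of the direction. -/
theorem gap_step_le (hγL : γ < 1 / (4 * L)) (hL : 0 < L) (hrpl : IsRPL f h γ μ) {x : E d}
    (hx : h x ≠ ⊤) (v : E d) :
    gap f h (prox h γ (x - γ • v)) ≤ rate γ μ * gap f h x
      - 3 / (8 * γ) * ‖prox h γ (x - γ • v) - x‖ ^ 2
      + γ / 2 * ‖v - gradient (avg f) x‖ ^ 2 := by
  have hy := prox_ne_top hprox hγ hx (x - γ • gradient (avg f) x)
  -- First compare the exact step `y` with `x`, where the direction error is zero; then the actual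
  -- step `p` with `y`.
  have h1 := gap_prox_le hconv hprox hγ hn hf (x := x) (v := gradient (avg f) x) hx
  have h2 := gap_prox_le hconv hprox hγ hn hf (x := x) (v := v) hy
  have h3 := hrpl x (objective_ne_top_iff.2 hx)
  rw [gradMap, norm_smul, Real.norm_of_nonneg (by positivity), norm_sub_rev] at h3
  set y := prox h γ (x - γ • gradient (avg f) x)
  set p := prox h γ (x - γ • v)
  -- Young's inequality, weighted so that the `‖p - y‖ ^ 2` term cancels the one in `h2`.
  have h4 : inner ℝ (gradient (avg f) x - v) (p - y)
      ≤ 1 / (2 * γ) * ‖p - y‖ ^ 2 + γ / 2 * ‖v - gradient (avg f) x‖ ^ 2 := by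
    have hi := real_inner_le_norm (gradient (avg f) x - v) (p - y)
    rw [norm_sub_rev (gradient (avg f) x) v] at hi
    have : 1 / (2 * γ) * ‖p - y‖ ^ 2 + γ / 2 * ‖v - gradient (avg f) x‖ ^ 2
        - ‖v - gradient (avg f) x‖ * ‖p - y‖
        = 1 / (2 * γ) * (‖p - y‖ - γ * ‖v - gradient (avg f) x‖) ^ 2 := by
      field_simp; ring
    have : 0 ≤ 1 / (2 * γ) * (‖p - y‖ - γ * ‖v - gradient (avg f) x‖) ^ 2 := by positivity
    linarith
  simp only [sub_self, inner_zero_left, norm_zero] at h1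
  have hLγ : L < 1 / (4 * γ) := by
    rw [lt_div_iff₀ (by positivity)] at hγL ⊢; linarith
  have e2 : 1 / (2 * γ) = 2 * (1 / (4 * γ)) := by field_simp; ring
  have e3 : 3 / (8 * γ) = 3 / 2 * (1 / (4 * γ)) := by field_simp; ring
  have h5 : γ / 4 * (1 / γ * ‖y - x‖) ^ 2 = 1 / (4 * γ) * ‖y - x‖ ^ 2 := by
    field_simp
  have h6 : γ / 4 * (2 * μ * gap f h x) ≤ 1 / (4 * γ) * ‖y - x‖ ^ 2 := by
    rw [← h5]; gcongr
  -- The total coefficient of `‖y - x‖ ^ 2` is `L - 1 / (2γ)`: half of the negative part absorbs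
  -- `L`, the other half is spent on RPL in `h6`.
  have h7 : (L - 1 / (4 * γ)) * ‖y - x‖ ^ 2 ≤ 0 :=
    mul_nonpos_of_nonpos_of_nonneg (by linarith) (by positivity)
  have h8 : (L / 2 - 1 / 2 * (1 / (4 * γ))) * ‖p - x‖ ^ 2 ≤ 0 :=
    mul_nonpos_of_nonpos_of_nonneg (by linarith) (by positivity)
  rw [rate, e3]
  rw [e2] at h1 h2 h4
  nlinarith

end Step

/-! ### Pathwise bounds for the surrogates of the gradient -/

section Surrogate

variable {d n b : ℕ}

theorem orthonormal_basisVec : Orthonormal ℝ (basisVec : Fin d → E d) := by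
  have hb : (basisVec : Fin d → E d) = EuclideanSpace.basisFun (Fin d) ℝ := by
    funext j; simp [basisVec]
  rw [hb]
  exact (EuclideanSpace.basisFun (Fin d) ℝ).orthonormal

theorem dirVec_apply (G : OGroup d) (j a : Fin d) :
    dirVec G j a = (G : Matrix (Fin d) (Fin d) ℝ) a j := by
  simp [dirVec, basisVec]

theorem orthonormal_dirVec (G : OGroup d) : Orthonormal ℝ (dirVec G) := by
  rw [orthonormal_iff_ite]
  intro j k
  have h := (Matrix.mem_orthogonalGroup_iff' (Fin d) ℝ).1 G.2
  have h2 := congrFun (congrFun h j) k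
  rw [Matrix.mul_apply, Matrix.one_apply] at h2
  rw [← h2, PiLp.inner_apply]
  refine Finset.sum_congr rfl fun a _ => ?_
  simp [dirVec_apply, mul_comm]

theorem norm_sq_sum_smul_of_orthonormal {ι V : Type*} [NormedAddCommGroup V]
    [InnerProductSpace ℝ V] {v : ι → V} (hv : Orthonormal ℝ v) (s : Finset ι) (c : ι → ℝ) :
    ‖∑ j ∈ s, c j • v j‖ ^ 2 = ∑ j ∈ s, c j ^ 2 := by
  rw [← real_inner_self_eq_norm_sq, hv.inner_sum]
  simp [sq]

theorem sum_basisVec (w : E d) : ∑ j, inner ℝ w (basisVec j) • basisVec j = w := by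
  ext a
  simp [basisVec, EuclideanSpace.inner_single_right, Finset.sum_apply, Pi.single_apply]

/-- The rescaled projection of `w` onto the span of the first `ℓ` columns of `G`. -/
@[irreducible] noncomputable def sketch (ℓ : ℕ) (G : OGroup d) (w : E d) : E d :=
  ((d : ℝ) / ℓ) • ∑ j : Fin d with j.val < ℓ, inner ℝ w (dirVec G j) • dirVec G j

theorem norm_sq_sketch (ℓ : ℕ) (G : OGroup d) (w : E d) :
    ‖sketch ℓ G w‖ ^ 2
      = ((d : ℝ) / ℓ) ^ 2 * ∑ j : Fin d with j.val < ℓ, inner ℝ w (dirVec G j) ^ 2 := by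
  rw [sketch, norm_smul, mul_pow, norm_sq_sum_smul_of_orthonormal (orthonormal_dirVec G),
    Real.norm_eq_abs, sq_abs]

/-- Bessel's inequality. Squared, it loses a factor `d / ℓ` against the mean, so it serves only to
bound the iterates and secure integrability. -/
theorem norm_sketch_le (ℓ : ℕ) (G : OGroup d) (w : E d) :
    ‖sketch ℓ G w‖ ≤ (d : ℝ) / ℓ * ‖w‖ := by
  refine le_of_sq_le_sq ?_ (by positivity)
  rw [norm_sq_sketch, mul_pow]
  gcongr
  have := (orthonormal_dirVec G).sum_inner_products_le (x := w)
    (s := Finset.univ.filter fun j : Fin d => j.val < ℓ)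
  simpa [real_inner_comm] using this

theorem abs_finiteDiff_sub_le {f : E d → ℝ} {L β : ℝ} (hβ : 0 < β)
    (hf : ∀ x y, |f y - f x - inner ℝ (gradient f x) (y - x)| ≤ L / 2 * ‖y - x‖ ^ 2) {v : E d}
    (hv : ‖v‖ = 1) (x : E d) :
    |(f (x + β • v) - f x) / β - inner ℝ (gradient f x) v| ≤ L / 2 * β := by
  have h1 := hf x (x + β • v)
  rw [add_sub_cancel_left, inner_smul_right, norm_smul, hv, Real.norm_of_nonneg hβ.le] at h1
  have h2 : (f (x + β • v) - f x) / β - inner ℝ (gradient f x) v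
      = (f (x + β • v) - f x - β * inner ℝ (gradient f x) v) / β := by field_simp
  rw [h2, abs_div, abs_of_pos hβ, div_le_iff₀ hβ]
  linarith

theorem norm_sq_fullApprox_sub_le {f : Fin n → E d → ℝ} {L β : ℝ} (hn : 0 < n)
    (hf : IsSmoothFamily f L) (hβ : 0 < β) (x : E d) :
    ‖fullApprox f β x - gradient (avg f) x‖ ^ 2 ≤ d * (L / 2 * β) ^ 2 := by
  conv_lhs => rw [← sum_basisVec (gradient (avg f) x)]
  rw [fullApprox, ← Finset.sum_sub_distrib]
  simp only [← sub_smul]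
  rw [norm_sq_sum_smul_of_orthonormal orthonormal_basisVec]
  calc _ ≤ ∑ _j : Fin d, (L / 2 * β) ^ 2 := Finset.sum_le_sum fun j _ =>
        sq_le_sq' (abs_le.1 (abs_finiteDiff_sub_le hβ (hf.abs_avg_le hn)
          (orthonormal_basisVec.1 j) x)).1
          (abs_le.1 (abs_finiteDiff_sub_le hβ (hf.abs_avg_le hn)
          (orthonormal_basisVec.1 j) x)).2
    _ = _ := by simp

theorem card_filter_val_lt_eq {ℓ : ℕ} (hℓd : ℓ ≤ d) :
    (Finset.univ.filter fun j : Fin d => j.val < ℓ).card = ℓ := by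
  rw [Fin.card_filter_val_lt, min_eq_right hℓd]

/-- The errors along the `ℓ` orthonormal columns add in squares, giving `(d / ℓ)² · ℓ · (Lβ / 2)²`.
The square root keeps the bound in a form that survives averaging over the batch. -/
theorem norm_stochApprox_sub_sketch_le {f : Fin n → E d → ℝ} {L β : ℝ} {ℓ : ℕ} (hℓ : 1 ≤ ℓ)
    (hℓd : ℓ ≤ d) (hf : IsSmoothFamily f L) (hβ : 0 < β) (i : Fin n) (G : OGroup d) (x : E d) :
    ‖stochApprox f ℓ β i G x - sketch ℓ G (gradient (f i) x)‖
      ≤ Real.sqrt ((d : ℝ) ^ 2 / ℓ * (L / 2 * β) ^ 2) := by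
  have hℓ' : (0 : ℝ) < ℓ := by exact_mod_cast hℓ
  apply Real.le_sqrt_of_sq_le
  rw [stochApprox, sketch, ← smul_sub, ← Finset.sum_sub_distrib]
  simp only [← sub_smul]
  rw [norm_smul, mul_pow, norm_sq_sum_smul_of_orthonormal (orthonormal_dirVec G),
    Real.norm_eq_abs, sq_abs]
  have hq : ∀ x y, |f i y - f i x - inner ℝ (gradient (f i) x) (y - x)| ≤ L / 2 * ‖y - x‖ ^ 2 :=
    abs_sub_sub_inner_gradient_le (hf i).1 (hf i).2
  calc _ ≤ ((d : ℝ) / ℓ) ^ 2 * ∑ _j : Fin d with _j.val < ℓ, (L / 2 * β) ^ 2 := by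
        refine mul_le_mul_of_nonneg_left (Finset.sum_le_sum fun j _ => ?_) (by positivity)
        have h1 := abs_finiteDiff_sub_le hβ hq ((orthonormal_dirVec G).1 j) x
        exact sq_le_sq.2 (h1.trans (le_abs_self _))
    _ = _ := by
        rw [Finset.sum_const, card_filter_val_lt_eq hℓd, nsmul_eq_mul]
        field_simp

/-- The linearization of the variance-reduced part of the search direction. -/
noncomputable def sketchDir (f : Fin n → E d → ℝ) (ℓ : ℕ) (ξ : Fin b → Fin n × OGroup d)
    (x₀ x : E d) : E d :=
  (1 / (b : ℝ)) • ∑ j, sketch ℓ (ξ j).2 (gradient (f (ξ j).1) x - gradient (f (ξ j).1) x₀)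

/-- The constant in the bound for the discretization error of the search direction. -/
noncomputable def biasConst (L : ℝ) (d ℓ : ℕ) : ℝ := 6 * L ^ 2 * (d : ℝ) ^ 2 / ℓ + L ^ 2 * d

theorem sketch_sub (ℓ : ℕ) (G : OGroup d) (u w : E d) :
    sketch ℓ G (u - w) = sketch ℓ G u - sketch ℓ G w := by
  simp only [sketch, inner_sub_left, sub_smul, Finset.sum_sub_distrib, smul_sub]

theorem norm_add_three_sq_le {V : Type*} [SeminormedAddCommGroup V] (u v w : V) :
    ‖u + v + w‖ ^ 2 ≤ 3 * ‖u‖ ^ 2 + 3 * ‖v‖ ^ 2 + 3 * ‖w‖ ^ 2 := by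
  have h1 : ‖u + v + w‖ ≤ ‖u‖ + ‖v‖ + ‖w‖ := norm_add₃_le
  have h2 : ‖u + v + w‖ ^ 2 ≤ (‖u‖ + ‖v‖ + ‖w‖) ^ 2 := by gcongr
  nlinarith [sq_nonneg (‖u‖ - ‖v‖), sq_nonneg (‖u‖ - ‖w‖), sq_nonneg (‖v‖ - ‖w‖)]

theorem norm_sq_searchDir_sub_le {f : Fin n → E d → ℝ} {L β : ℝ} {ℓ : ℕ} (hn : 0 < n)
    (hb : 0 < b) (hℓ : 1 ≤ ℓ) (hℓd : ℓ ≤ d) (hf : IsSmoothFamily f L) (hβ : 0 < β)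
    (ξ : Fin b → Fin n × OGroup d) (x₀ x : E d) :
    ‖searchDir f ℓ β ξ x₀ x - gradient (avg f) x‖ ^ 2
      ≤ 3 * ‖sketchDir f ℓ ξ x₀ x - (gradient (avg f) x - gradient (avg f) x₀)‖ ^ 2
        + biasConst L d ℓ * β ^ 2 := by
  have hℓ' : (0 : ℝ) < ℓ := by exact_mod_cast hℓ
  set r : Fin b → E d → E d := fun j y =>
    stochApprox f ℓ β (ξ j).1 (ξ j).2 y - sketch ℓ (ξ j).2 (gradient (f (ξ j).1) y) with hr
  -- Three sources of error: fluctuation of the sketches, finite differences in the batch at `x` and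
  -- `x₀`, and finite differences in the full surrogate. The last two need only `3` and `3 / 4`
  -- where `biasConst` has `6` and `1`.
  have hdec : searchDir f ℓ β ξ x₀ x - gradient (avg f) x
      = (sketchDir f ℓ ξ x₀ x - (gradient (avg f) x - gradient (avg f) x₀))
        + (1 / (b : ℝ)) • ∑ j, (r j x - r j x₀)
        + (fullApprox f β x₀ - gradient (avg f) x₀) := by
    simp only [searchDir, sketchDir, hr, sketch_sub, Finset.sum_sub_distrib, smul_sub]
    abel
  have hB : ‖(1 / (b : ℝ)) • ∑ j, (r j x - r j x₀)‖
      ≤ 2 * Real.sqrt ((d : ℝ) ^ 2 / ℓ * (L / 2 * β) ^ 2) :=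
    norm_avg_le hb fun j => (norm_sub_le _ _).trans (by
      have h1 := norm_stochApprox_sub_sketch_le hℓ hℓd hf hβ (ξ j).1 (ξ j).2 x
      have h2 := norm_stochApprox_sub_sketch_le hℓ hℓd hf hβ (ξ j).1 (ξ j).2 x₀
      simp only [hr]; linarith)
  have hB2 : ‖(1 / (b : ℝ)) • ∑ j, (r j x - r j x₀)‖ ^ 2
      ≤ (d : ℝ) ^ 2 / ℓ * L ^ 2 * β ^ 2 := by
    calc _ ≤ (2 * Real.sqrt ((d : ℝ) ^ 2 / ℓ * (L / 2 * β) ^ 2)) ^ 2 := by gcongr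
      _ = _ := by rw [mul_pow, Real.sq_sqrt (by positivity)]; ring
  have hC := norm_sq_fullApprox_sub_le hn hf hβ x₀
  rw [hdec]
  refine (norm_add_three_sq_le _ _ _).trans ?_
  have h1 : 0 ≤ (d : ℝ) ^ 2 / ℓ * L ^ 2 * β ^ 2 := by positivity
  have h2 : 0 ≤ d * (L * β) ^ 2 := by positivity
  have h3 : biasConst L d ℓ * β ^ 2
      = 6 * ((d : ℝ) ^ 2 / ℓ * L ^ 2 * β ^ 2) + d * (L * β) ^ 2 := by rw [biasConst]; ring
  rw [h3]
  nlinarith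

theorem norm_sketchDir_sub_le {f : Fin n → E d → ℝ} {L : ℝ} {ℓ : ℕ} (hn : 0 < n) (hb : 0 < b)
    (hf : IsSmoothFamily f L) (ξ : Fin b → Fin n × OGroup d) (x₀ x : E d) :
    ‖sketchDir f ℓ ξ x₀ x - (gradient (avg f) x - gradient (avg f) x₀)‖
      ≤ ((d : ℝ) / ℓ + 1) * L * ‖x - x₀‖ := by
  have h1 : ‖sketchDir f ℓ ξ x₀ x‖ ≤ (d : ℝ) / ℓ * (L * ‖x - x₀‖) :=
    norm_avg_le hb fun j => (norm_sketch_le _ _ _).trans (by gcongr; exact (hf _).2 x x₀)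
  have h2 := hf.norm_gradient_avg_sub_le hn x x₀
  refine (norm_sub_le _ _).trans ?_
  linarith

end Surrogate

/-! ### Second moments of the Haar measure on the orthogonal group -/

section Haar

variable {d n b : ℕ}

theorem sum_sq_orthogonal_col (G : OGroup d) (k : Fin d) :
    ∑ a, (G : Matrix (Fin d) (Fin d) ℝ) a k ^ 2 = 1 := by
  have h := (orthonormal_dirVec G).1 k
  rw [EuclideanSpace.norm_eq, Real.sqrt_eq_one] at h
  simpa [dirVec_apply] using h

theorem abs_orthogonal_apply_le (G : OGroup d) (a k : Fin d) :
    |(G : Matrix (Fin d) (Fin d) ℝ) a k| ≤ 1 := by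
  rw [← sq_le_one_iff_abs_le_one, ← sum_sq_orthogonal_col G k]
  exact Finset.single_le_sum (f := fun a => (G : Matrix (Fin d) (Fin d) ℝ) a k ^ 2)
    (fun a _ => sq_nonneg _) (Finset.mem_univ a)

theorem continuous_orthogonal_apply (a k : Fin d) :
    Continuous fun G : OGroup d => (G : Matrix (Fin d) (Fin d) ℝ) a k :=
  continuous_subtype_val.matrix_elem a k

/-- The orthogonal matrix that changes the sign of the coordinate `a`. -/
def signFlip (a : Fin d) : OGroup d :=
  ⟨Matrix.diagonal fun i => if i = a then -1 else 1, by
    rw [Matrix.mem_orthogonalGroup_iff, Matrix.diagonal_transpose,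
      Matrix.diagonal_mul_diagonal, ← Matrix.diagonal_one]
    congr 1; funext i; by_cases h : i = a <;> simp [h]⟩

theorem signFlip_mul_apply (a i k : Fin d) (G : OGroup d) :
    ((signFlip a * G : OGroup d) : Matrix (Fin d) (Fin d) ℝ) i k
      = (if i = a then -1 else 1) * (G : Matrix (Fin d) (Fin d) ℝ) i k :=
  Matrix.diagonal_mul _ _ _ _

/-- The orthogonal matrix that permutes the coordinates. -/
def permOrthogonal (σ : Equiv.Perm (Fin d)) : OGroup d :=
  ⟨Matrix.of fun i j => if σ i = j then 1 else 0, by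
    rw [Matrix.mem_orthogonalGroup_iff]
    ext i j
    simp [Matrix.mul_apply, Matrix.one_apply, eq_comm]⟩

theorem permOrthogonal_mul_apply (σ : Equiv.Perm (Fin d)) (i k : Fin d) (G : OGroup d) :
    ((permOrthogonal σ * G : OGroup d) : Matrix (Fin d) (Fin d) ℝ) i k
      = (G : Matrix (Fin d) (Fin d) ℝ) (σ i) k := by
  change ((permOrthogonal σ : Matrix (Fin d) (Fin d) ℝ) * (G : Matrix (Fin d) (Fin d) ℝ)) i k = _
  simp [Matrix.mul_apply, permOrthogonal]

variable (Q : Measure (OGroup d)) [IsProbabilityMeasure Q]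

theorem integrable_orthogonal_mul (a a' k : Fin d) :
    Integrable (fun G : OGroup d => (G : Matrix (Fin d) (Fin d) ℝ) a k
      * (G : Matrix (Fin d) (Fin d) ℝ) a' k) Q := by
  refine Integrable.of_bound ((continuous_orthogonal_apply a k).mul
    (continuous_orthogonal_apply a' k)).measurable.aestronglyMeasurable 1 (ae_of_all _ fun G => ?_)
  rw [norm_mul]
  exact mul_le_one₀ (abs_orthogonal_apply_le G a k) (abs_nonneg _) (abs_orthogonal_apply_le G a' k)

variable [Q.IsMulLeftInvariant]

/-- Swapping rows preserves the measure, so the `d` second moments in a column agree, and they sum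
to `1`. Flipping the sign of one row shows that a mixed moment equals its own negative. -/
theorem integral_orthogonal_mul (a a' k : Fin d) :
    ∫ G : OGroup d, (G : Matrix (Fin d) (Fin d) ℝ) a k * (G : Matrix (Fin d) (Fin d) ℝ) a' k ∂Q
      = if a = a' then 1 / (d : ℝ) else 0 := by
  split_ifs with haa
  · subst haa
    have hsame : ∀ i, ∫ G : OGroup d, (G : Matrix (Fin d) (Fin d) ℝ) i k
          * (G : Matrix (Fin d) (Fin d) ℝ) i k ∂Q
        = ∫ G : OGroup d, (G : Matrix (Fin d) (Fin d) ℝ) a k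
          * (G : Matrix (Fin d) (Fin d) ℝ) a k ∂Q := fun i => by
      rw [← integral_mul_left_eq_self _ (permOrthogonal (Equiv.swap a i))]
      simp [permOrthogonal_mul_apply]
    have hsum : ∑ i, ∫ G : OGroup d, (G : Matrix (Fin d) (Fin d) ℝ) i k
        * (G : Matrix (Fin d) (Fin d) ℝ) i k ∂Q = 1 := by
      rw [← integral_finsetSum _ fun i _ => integrable_orthogonal_mul Q i i k]
      simp [← sq, sum_sq_orthogonal_col]
    rw [Finset.sum_congr rfl fun i _ => hsame i] at hsum
    have hd : (d : ℝ) ≠ 0 := by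
      have := a.pos
      positivity
    simp only [Finset.sum_const, Finset.card_univ, Fintype.card_fin, nsmul_eq_mul] at hsum
    rw [eq_div_iff hd, mul_comm, hsum]
  · have h := integral_mul_left_eq_self (μ := Q) (fun G : OGroup d =>
      (G : Matrix (Fin d) (Fin d) ℝ) a k * (G : Matrix (Fin d) (Fin d) ℝ) a' k) (signFlip a)
    simp only [signFlip_mul_apply, if_true, if_neg (Ne.symm haa), one_mul, neg_mul] at h
    rw [integral_neg] at h
    linarith

theorem inner_dirVec (w : E d) (G : OGroup d) (j : Fin d) :
    inner ℝ w (dirVec G j) = ∑ a, w a * (G : Matrix (Fin d) (Fin d) ℝ) a j := by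
  rw [PiLp.inner_apply]
  exact Finset.sum_congr rfl fun a _ => by simp [dirVec_apply, mul_comm]

theorem integral_inner_dirVec_mul (w : E d) (j a : Fin d) :
    Integrable (fun G : OGroup d => inner ℝ w (dirVec G j) * dirVec G j a) Q ∧
    ∫ G : OGroup d, inner ℝ w (dirVec G j) * dirVec G j a ∂Q = w a / d := by
  have h : ∀ G : OGroup d, inner ℝ w (dirVec G j) * dirVec G j a
      = ∑ i, w i * ((G : Matrix (Fin d) (Fin d) ℝ) i j * (G : Matrix (Fin d) (Fin d) ℝ) a j) :=
    fun G => by simp only [inner_dirVec, dirVec_apply, Finset.sum_mul, mul_assoc]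
  simp only [h]
  have hint := fun i => (integrable_orthogonal_mul Q i a j).const_mul (w i)
  refine ⟨integrable_finsetSum _ fun i _ => hint i, ?_⟩
  rw [integral_finsetSum _ fun i _ => hint i]
  simp [integral_const_mul, integral_orthogonal_mul, div_eq_mul_inv]

theorem integral_inner_dirVec_sq (w : E d) (j : Fin d) :
    Integrable (fun G : OGroup d => inner ℝ w (dirVec G j) ^ 2) Q ∧
    ∫ G : OGroup d, inner ℝ w (dirVec G j) ^ 2 ∂Q = ‖w‖ ^ 2 / d := by
  have h : ∀ G : OGroup d, inner ℝ w (dirVec G j) ^ 2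
      = ∑ a, w a * (inner ℝ w (dirVec G j) * dirVec G j a) := fun G => by
    rw [sq]
    nth_rw 1 [inner_dirVec]
    simp only [dirVec_apply, Finset.sum_mul]
    exact Finset.sum_congr rfl fun a _ => by ring
  simp only [h]
  have hint := fun a => (integral_inner_dirVec_mul Q w j a).1.const_mul (w a)
  refine ⟨integrable_finsetSum _ fun a _ => hint a, ?_⟩
  rw [integral_finsetSum _ fun a _ => hint a, EuclideanSpace.real_norm_sq_eq, Finset.sum_div]
  exact Finset.sum_congr rfl fun a _ => by
    rw [integral_const_mul, (integral_inner_dirVec_mul Q w j a).2]; ring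

variable {ℓ : ℕ} (hℓ : 1 ≤ ℓ) (hℓd : ℓ ≤ d)

theorem sketch_apply (ℓ : ℕ) (G : OGroup d) (w : E d) (a : Fin d) :
    sketch ℓ G w a
      = (d : ℝ) / ℓ * ∑ j : Fin d with j.val < ℓ, inner ℝ w (dirVec G j) * dirVec G j a := by
  simp [sketch, Finset.sum_apply]

include hℓ hℓd

/-- Unbiasedness: each of the `ℓ` projections has mean `w / d`, which the prefactor `d / ℓ`
compensates. -/
theorem integral_sketch_apply (w : E d) (a : Fin d) :
    ∫ G : OGroup d, sketch ℓ G w a ∂Q = w a := by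
  have hℓ' : (ℓ : ℝ) ≠ 0 := by positivity
  have hd' : (d : ℝ) ≠ 0 := by have := hℓ.trans hℓd; positivity
  simp only [sketch_apply]
  rw [integral_const_mul, integral_finsetSum _ fun j _ => (integral_inner_dirVec_mul Q w j a).1,
    Finset.sum_congr rfl fun j _ => (integral_inner_dirVec_mul Q w j a).2, Finset.sum_const,
    card_filter_val_lt_eq hℓd, nsmul_eq_mul]
  field_simp

theorem integral_norm_sq_sketch (w : E d) :
    ∫ G : OGroup d, ‖sketch ℓ G w‖ ^ 2 ∂Q = (d : ℝ) / ℓ * ‖w‖ ^ 2 := by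
  have hℓ' : (ℓ : ℝ) ≠ 0 := by positivity
  have hd' : (d : ℝ) ≠ 0 := by have := hℓ.trans hℓd; positivity
  simp only [norm_sq_sketch]
  rw [integral_const_mul, integral_finsetSum _ fun j _ => (integral_inner_dirVec_sq Q w j).1,
    Finset.sum_congr rfl fun j _ => (integral_inner_dirVec_sq Q w j).2, Finset.sum_const,
    card_filter_val_lt_eq hℓd, nsmul_eq_mul]
  field_simp

end Haar

/-! ### The variance of a batch -/

section Batch

variable {d n b : ℕ} {Ω : Type*} [MeasurableSpace Ω]

/-- A uniform index together with an independent Haar distributed orthogonal matrix. -/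
structure IsDraw (P : Measure Ω) (I : Ω → Fin n) (G : Ω → OGroup d) : Prop where
  measurable_index : Measurable I
  measurable_matrix : Measurable G
  uniform_index : ∀ i, P {ω | I ω = i} = (n : ENNReal)⁻¹
  haar_matrix : (P.map G).IsHaarMeasure
  indep : IndepFun I G P

variable {P : Measure Ω} [IsProbabilityMeasure P]

theorem IsDraw.integral_eq {I : Ω → Fin n} {G : Ω → OGroup d} (hD : IsDraw P I G)
    {φ : Fin n → OGroup d → ℝ} (hφ : ∀ i, Measurable (φ i)) {C : ℝ} (hC : ∀ i g, |φ i g| ≤ C) :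
    ∫ ω, φ (I ω) (G ω) ∂P = 1 / (n : ℝ) * ∑ i, ∫ g, φ i g ∂(P.map G) := by
  have hG := hD.measurable_matrix
  have hset : ∀ i, MeasurableSet {ω | I ω = i} := fun i =>
    hD.measurable_index (measurableSet_singleton i)
  -- Splitting over the values of the index turns the integrand into products of independent
  -- factors.
  have hsplit : ∀ ω, φ (I ω) (G ω)
      = ∑ i, ({i} : Set (Fin n)).indicator (fun _ => (1 : ℝ)) (I ω) * φ i (G ω) := fun ω => by
    simp [Set.indicator_apply]
  have hind : ∀ i, Measurable fun ω => ({i} : Set (Fin n)).indicator (fun _ => (1 : ℝ)) (I ω) :=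
    fun i => (measurable_const.indicator (measurableSet_singleton i)).comp hD.measurable_index
  have hi : ∀ i, Integrable
      (fun ω => ({i} : Set (Fin n)).indicator (fun _ => (1 : ℝ)) (I ω) * φ i (G ω)) P := fun i => by
    refine Integrable.of_bound ((hind i).mul ((hφ i).comp hG)).aestronglyMeasurable C
      (ae_of_all _ fun ω => ?_)
    have h0 : 0 ≤ C := (abs_nonneg _).trans (hC i (G ω))
    by_cases h : I ω = i
    · simpa [h] using hC i (G ω)
    · simpa [h] using h0
  simp only [hsplit]
  rw [integral_finsetSum _ fun i _ => hi i, Finset.mul_sum]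
  refine Finset.sum_congr rfl fun i _ => ?_
  have hindep : IndepFun (fun ω => ({i} : Set (Fin n)).indicator (fun _ => (1 : ℝ)) (I ω))
      (fun ω => φ i (G ω)) P :=
    hD.indep.comp (measurable_const.indicator (measurableSet_singleton i)) (hφ i)
  rw [hindep.integral_fun_mul_eq_mul_integral (hind i).aestronglyMeasurable
    ((hφ i).comp hG).aestronglyMeasurable,
    integral_map hG.aemeasurable (hφ i).aestronglyMeasurable]
  congr 1
  have : (fun ω => ({i} : Set (Fin n)).indicator (fun _ => (1 : ℝ)) (I ω))
      = {ω | I ω = i}.indicator fun _ => (1 : ℝ) := by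
    funext ω; simp [Set.indicator_apply]
  rw [this, integral_indicator_const _ (hset i), measureReal_def, hD.uniform_index]
  simp

theorem measurable_dirVec (j : Fin d) : Measurable fun G : OGroup d => dirVec G j := by
  have : Continuous fun G : OGroup d => dirVec G j := by
    refine (PiLp.continuous_toLp 2 _).comp (continuous_pi fun a => ?_)
    exact (continuous_orthogonal_apply a j).congr fun G => (dirVec_apply G j a).symm
  exact this.measurable

theorem measurable_sketch (ℓ : ℕ) (w : E d) : Measurable fun G : OGroup d => sketch ℓ G w := by
  have := measurable_dirVec (d := d)
  unfold sketch
  fun_prop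

theorem measurable_sketch_draw (ℓ : ℕ) (w : Fin n → E d) :
    Measurable fun p : Fin n × OGroup d => sketch ℓ p.2 (w p.1) :=
  measurable_from_prod_countable_right fun i => measurable_sketch ℓ (w i)

theorem measurable_coord (a : Fin d) : Measurable fun w : E d => w a := by fun_prop

theorem abs_apply_le_norm (w : E d) (a : Fin d) : |w a| ≤ ‖w‖ := by
  simpa using PiLp.norm_apply_le w a

/-- Variances of pairwise independent variables add, and each variance is at most the second moment;
so the individual means need not be subtracted on the right. -/
theorem integral_avg_sub_sq_le (hb : 0 < b) {X : Fin b → Ω → ℝ} {M : ℝ}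
    (hX : ∀ j, MemLp (X j) 2 P) (hind : ∀ j j', j ≠ j' → IndepFun (X j) (X j') P)
    (hmean : ∀ j, ∫ ω, X j ω ∂P = M) :
    ∫ ω, (1 / (b : ℝ) * ∑ j, X j ω - M) ^ 2 ∂P ≤ (1 / (b : ℝ)) ^ 2 * ∑ j, ∫ ω, X j ω ^ 2 ∂P := by
  have hb' : (0 : ℝ) < b := by exact_mod_cast hb
  have hSL : MemLp (∑ j, X j) 2 P := memLp_finsetSum' _ fun j _ => hX j
  have hSmean : ∫ ω, (∑ j, X j) ω ∂P = b * M := by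
    simp only [Finset.sum_apply]
    rw [integral_finsetSum _ fun j _ => (hX j).integrable one_le_two]
    simp [hmean]
  have hpt : ∀ ω, (1 / (b : ℝ) * ∑ j, X j ω - M) ^ 2
      = (1 / (b : ℝ)) ^ 2 * ((∑ j, X j) ω - ∫ ω, (∑ j, X j) ω ∂P) ^ 2 := fun ω => by
    rw [hSmean, ← mul_pow, Finset.sum_apply]
    congr 1
    field_simp
  simp only [hpt]
  rw [integral_const_mul, ← variance_eq_integral hSL.aestronglyMeasurable.aemeasurable,
    IndepFun.variance_sum (fun j _ => hX j) (fun j _ j' _ hjj => hind j j' hjj)]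
  gcongr with j _
  exact variance_le_expectation_sq (hX j).aestronglyMeasurable

/-- The variance of an average of pairwise independent, bounded random vectors. -/
theorem integral_norm_sq_avg_sub_le (hb : 0 < b) {Y : Fin b → Ω → E d} {M : E d} {K V : ℝ}
    (hYm : ∀ j, Measurable (Y j)) (hYb : ∀ j ω, ‖Y j ω‖ ≤ K)
    (hind : ∀ j j', j ≠ j' → IndepFun (Y j) (Y j') P)
    (hmean : ∀ j a, ∫ ω, Y j ω a ∂P = M a) (hV : ∀ j, ∫ ω, ‖Y j ω‖ ^ 2 ∂P ≤ V) :
    ∫ ω, ‖(1 / (b : ℝ)) • ∑ j, Y j ω - M‖ ^ 2 ∂P ≤ 1 / b * V := by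
  have hb' : (0 : ℝ) < b := by exact_mod_cast hb
  have hL2 : ∀ j a, MemLp (fun ω => Y j ω a) 2 P := fun j a =>
    MemLp.of_bound ((measurable_coord a).comp (hYm j)).aestronglyMeasurable K
      (ae_of_all _ fun ω => (abs_apply_le_norm _ a).trans (hYb j ω))
  have hdiff : ∀ a, MemLp (fun ω => 1 / (b : ℝ) * ∑ j, Y j ω a - M a) 2 P := fun a =>
    ((memLp_finsetSum _ fun j _ => hL2 j a).const_mul _).sub (memLp_const _)
  have hpt : ∀ ω, ‖(1 / (b : ℝ)) • ∑ j, Y j ω - M‖ ^ 2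
      = ∑ a, (1 / (b : ℝ) * ∑ j, Y j ω a - M a) ^ 2 := fun ω => by
    rw [EuclideanSpace.real_norm_sq_eq]
    exact Finset.sum_congr rfl fun a _ => by simp [Finset.sum_apply]
  simp only [hpt]
  rw [integral_finsetSum _ fun a _ => (hdiff a).integrable_sq]
  calc _ ≤ ∑ a, (1 / (b : ℝ)) ^ 2 * ∑ j, ∫ ω, Y j ω a ^ 2 ∂P := Finset.sum_le_sum fun a _ =>
        integral_avg_sub_sq_le hb (fun j => hL2 j a) (fun j j' hjj => (hind j j' hjj).comp
          (measurable_coord a) (measurable_coord a)) (fun j => hmean j a)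
    _ = (1 / (b : ℝ)) ^ 2 * ∑ j, ∫ ω, ‖Y j ω‖ ^ 2 ∂P := by
        rw [← Finset.mul_sum, Finset.sum_comm]
        congr 1
        refine Finset.sum_congr rfl fun j _ => ?_
        rw [← integral_finsetSum _ fun a _ => (hL2 j a).integrable_sq]
        simp only [EuclideanSpace.real_norm_sq_eq]
    _ ≤ (1 / (b : ℝ)) ^ 2 * ∑ _j : Fin b, V := by
        gcongr with j _; exact hV j
    _ = _ := by simp; field_simp

variable {ℓ : ℕ} (hℓ : 1 ≤ ℓ) (hℓd : ℓ ≤ d) {w : Fin n → E d} {c : ℝ} (hw : ∀ i, ‖w i‖ ≤ c)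

include hw in
theorem norm_sketch_draw_le (i : Fin n) (G : OGroup d) : ‖sketch ℓ G (w i)‖ ≤ (d : ℝ) / ℓ * c :=
  (norm_sketch_le _ _ _).trans (by gcongr; exact hw i)

include hℓ hℓd hw

theorem IsDraw.integral_sketch_apply {I : Ω → Fin n} {G : Ω → OGroup d} (hD : IsDraw P I G)
    (a : Fin d) :
    ∫ ω, sketch ℓ (G ω) (w (I ω)) a ∂P = ((1 / (n : ℝ)) • ∑ i, w i) a := by
  have := hD.haar_matrix
  have : IsProbabilityMeasure (P.map G) :=
    Measure.isProbabilityMeasure_map hD.measurable_matrix.aemeasurable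
  rw [hD.integral_eq (φ := fun i g => sketch ℓ g (w i) a)
    (fun i => (measurable_coord a).comp (measurable_sketch ℓ (w i)))
    (fun i g => (abs_apply_le_norm _ a).trans (norm_sketch_draw_le hw i g))]
  simp only [VRSZD.integral_sketch_apply _ hℓ hℓd]
  simp [Finset.sum_apply]

theorem IsDraw.integral_norm_sq_sketch_le {I : Ω → Fin n} {G : Ω → OGroup d} (hn : 0 < n)
    (hD : IsDraw P I G) :
    ∫ ω, ‖sketch ℓ (G ω) (w (I ω))‖ ^ 2 ∂P ≤ (d : ℝ) / ℓ * c ^ 2 := by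
  have := hD.haar_matrix
  have : IsProbabilityMeasure (P.map G) :=
    Measure.isProbabilityMeasure_map hD.measurable_matrix.aemeasurable
  have hn' : (0 : ℝ) < n := by exact_mod_cast hn
  rw [hD.integral_eq (φ := fun i g => ‖sketch ℓ g (w i)‖ ^ 2) (C := ((d : ℝ) / ℓ * c) ^ 2)
    (fun i => (measurable_sketch ℓ (w i)).norm.pow_const 2)
    (fun i g => by rw [abs_pow, abs_norm]; gcongr; exact norm_sketch_draw_le hw i g)]
  simp only [integral_norm_sq_sketch _ hℓ hℓd]
  calc _ ≤ 1 / (n : ℝ) * ∑ _i : Fin n, (d : ℝ) / ℓ * c ^ 2 := by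
        gcongr with i _; exact hw i
    _ = _ := by simp; field_simp

/-- The variance of an average of independent sketches. -/
theorem integral_norm_sq_batch_le (hn : 0 < n) (hb : 0 < b) {I : Fin b → Ω → Fin n}
    {G : Fin b → Ω → OGroup d} (hD : ∀ j, IsDraw P (I j) (G j))
    (hind : iIndepFun (fun j ω => (I j ω, G j ω)) P) :
    ∫ ω, ‖(1 / (b : ℝ)) • ∑ j, sketch ℓ (G j ω) (w (I j ω)) - (1 / (n : ℝ)) • ∑ i, w i‖ ^ 2 ∂P
      ≤ 1 / b * ((d : ℝ) / ℓ * c ^ 2) :=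
  integral_norm_sq_avg_sub_le (Y := fun j ω => sketch ℓ (G j ω) (w (I j ω)))
    (M := (1 / (n : ℝ)) • ∑ i, w i) hb
    (fun j => (measurable_sketch_draw ℓ w).comp
      ((hD j).measurable_index.prodMk (hD j).measurable_matrix))
    (fun j ω => norm_sketch_draw_le hw (I j ω) (G j ω))
    (fun _ _ hjj => (hind.indepFun hjj).comp (measurable_sketch_draw ℓ w)
      (measurable_sketch_draw ℓ w))
    (fun j a => (hD j).integral_sketch_apply hℓ hℓd hw a)
    (fun j => (hD j).integral_norm_sq_sketch_le hℓ hℓd hw hn)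

end Batch

/-! ### Measurability of the iterates -/

section Measurability

variable {d n b : ℕ} {Ω : Type*} [MeasurableSpace Ω] {f : Fin n → E d → ℝ} {h : E d → EReal}
  {γ : ℝ} {ℓ m : ℕ}

theorem measurable_apply_index {F : Type*} [TopologicalSpace F] [MeasurableSpace F] [BorelSpace F]
    {w : Fin n → E d → F} (hw : ∀ i, Continuous (w i)) {I : Ω → Fin n}
    {X : Ω → E d} (hI : Measurable I) (hX : Measurable X) :
    Measurable fun ω => w (I ω) (X ω) := by
  have h1 : Measurable fun p : Fin n × E d => w p.1 p.2 :=
    measurable_from_prod_countable_right fun i => (hw i).measurable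
  exact h1.comp (hI.prodMk hX)

theorem measurable_stochApprox (hf : ∀ i, Continuous (f i)) (ℓ : ℕ) (β : ℝ) {I : Ω → Fin n}
    {G : Ω → OGroup d} {X : Ω → E d} (hI : Measurable I) (hG : Measurable G)
    (hX : Measurable X) : Measurable fun ω => stochApprox f ℓ β (I ω) (G ω) (X ω) := by
  have hdir : ∀ j, Measurable fun ω => dirVec (G ω) j := fun j => (measurable_dirVec j).comp hG
  have h0 : Measurable fun ω => f (I ω) (X ω) := measurable_apply_index hf hI hX
  have h1 : ∀ j, Measurable fun ω => f (I ω) (X ω + β • dirVec (G ω) j) := fun j =>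
    measurable_apply_index hf hI (hX.add ((hdir j).const_smul β))
  unfold stochApprox
  exact (Finset.measurable_sum _ fun j _ =>
    (((h1 j).sub h0).div_const β).smul (hdir j)).const_smul ((d : ℝ) / ℓ)

theorem measurable_searchDir (hf : ∀ i, Continuous (f i)) (ℓ : ℕ) (β : ℝ)
    {ξ : Ω → Fin b → Fin n × OGroup d} {X₀ X : Ω → E d} (hξ : ∀ j, Measurable fun ω => ξ ω j)
    (hX₀ : Measurable X₀) (hX : Measurable X) :
    Measurable fun ω => searchDir f ℓ β (ξ ω) (X₀ ω) (X ω) := by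
  have hs : ∀ {Y : Ω → E d}, Measurable Y → ∀ j,
      Measurable fun ω => stochApprox f ℓ β (ξ ω j).1 (ξ ω j).2 (Y ω) := fun hY j =>
    measurable_stochApprox hf ℓ β (hξ j).fst (hξ j).snd hY
  have havg : Continuous (avg f) := by unfold avg; fun_prop
  have hfull : Continuous (fullApprox f β) := by unfold fullApprox; fun_prop
  unfold searchDir
  exact ((Finset.measurable_sum _ fun j _ => (hs hX j).sub (hs hX₀ j)).const_smul (1 / (b : ℝ))).add
    (hfull.measurable.comp hX₀)

/-- Only the draws before step `k` are assumed measurable. The lemma can thus be applied with the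
σ-algebra of the past draws in place of the ambient one, which is how independence is obtained. -/
theorem measurable_innerIter (hf : ∀ i, Continuous (f i)) (hp : Continuous (prox h γ)) (β : ℝ)
    {ξ : Ω → ℕ → Fin b → Fin n × OGroup d} {X₀ : Ω → E d} (hX₀ : Measurable X₀) (k : ℕ)
    (hξ : ∀ k' < k, ∀ j, Measurable fun ω => ξ ω k' j) :
    Measurable fun ω => innerIter f h γ ℓ β (ξ ω) (X₀ ω) k := by
  induction k with
  | zero => exact hX₀
  | succ k ih =>
    have ihk := ih fun k' hk' => hξ k' (hk'.trans k.lt_succ_self)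
    exact hp.measurable.comp (ihk.sub
      ((measurable_searchDir hf ℓ β (hξ k k.lt_succ_self) hX₀ ihk).const_smul γ))

theorem measurable_outerIter (hf : ∀ i, Continuous (f i)) (hp : Continuous (prox h γ))
    (β : ℕ → ℝ) {ξ : Ω → ℕ → ℕ → Fin b → Fin n × OGroup d} (x₀ : E d) (τ : ℕ)
    (hξ : ∀ τ' < τ, ∀ k j, Measurable fun ω => ξ ω τ' k j) :
    Measurable fun ω => outerIter f h γ ℓ m β (ξ ω) x₀ τ := by
  induction τ with
  | zero => exact measurable_const
  | succ τ ih =>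
    exact measurable_innerIter hf hp (β τ) (ih fun τ' h' => hξ τ' (h'.trans τ.lt_succ_self)) m
      fun k _ j => hξ τ τ.lt_succ_self k j

end Measurability

/-! ### Independence of the iterates and the current batch -/

section Independence

variable {d n b : ℕ} {Ω : Type*} [MeasurableSpace Ω] {P : Measure Ω} {f : Fin n → E d → ℝ}
  {h : E d → EReal} {γ : ℝ} {ℓ m : ℕ}

theorem IsSampling.measurable_draws {I : ℕ → ℕ → Fin b → Ω → Fin n}
    {G : ℕ → ℕ → Fin b → Ω → OGroup d} (hS : IsSampling P I G) (τ k : ℕ) (j : Fin b) :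
    Measurable fun ω => draws I G ω τ k j :=
  (hS.measurable_index τ k j).prodMk (hS.measurable_matrix τ k j)

theorem IsSampling.isDraw {I : ℕ → ℕ → Fin b → Ω → Fin n}
    {G : ℕ → ℕ → Fin b → Ω → OGroup d} (hS : IsSampling P I G) (τ k : ℕ) (j : Fin b) :
    IsDraw P (I τ k j) (G τ k j) :=
  ⟨hS.measurable_index τ k j, hS.measurable_matrix τ k j, hS.uniform_index τ k j,
    hS.haar_matrix τ k j, hS.indep_index_matrix τ k j⟩

theorem IsSampling.iIndepFun_batch {I : ℕ → ℕ → Fin b → Ω → Fin n}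
    {G : ℕ → ℕ → Fin b → Ω → OGroup d} (hS : IsSampling P I G) (τ k : ℕ) :
    iIndepFun (fun j ω => (I τ k j ω, G τ k j ω)) P :=
  hS.indep_draws.precomp (g := fun j : Fin b => (τ, k, j)) fun i j hij => by simpa using hij

/-- The iterates are independent of the batch drawn next. -/
theorem IsSampling.indepFun_iterates (hf : ∀ i, Continuous (f i)) (hp : Continuous (prox h γ))
    (β : ℕ → ℝ) (x₀ : E d) {I : ℕ → ℕ → Fin b → Ω → Fin n} {G : ℕ → ℕ → Fin b → Ω → OGroup d}
    (hS : IsSampling P I G) (τ k : ℕ) :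
    IndepFun (fun ω => (outerIter f h γ ℓ m β (draws I G ω) x₀ τ,
        innerIter f h γ ℓ (β τ) (draws I G ω τ) (outerIter f h γ ℓ m β (draws I G ω) x₀ τ) k))
      (fun ω => draws I G ω τ k) P := by
  -- Disjoint sets of draws generate independent σ-algebras; the iterates are measurable for the
  -- first, the batch for the second.
  set past : Set (ℕ × ℕ × Fin b) := {s | s.1 < τ ∨ s.1 = τ ∧ s.2.1 < k} with hpast
  set current : Set (ℕ × ℕ × Fin b) := {s | s.1 = τ ∧ s.2.1 = k} with hcurrent
  set σ : ℕ × ℕ × Fin b → MeasurableSpace Ω := fun s =>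
    MeasurableSpace.comap (fun ω => draws I G ω s.1 s.2.1 s.2.2) inferInstance with hσ
  have hle : ∀ s, σ s ≤ ‹MeasurableSpace Ω› := fun s =>
    (hS.measurable_draws s.1 s.2.1 s.2.2).comap_le
  have hdisj : Disjoint past current := by
    rw [Set.disjoint_left]
    rintro s hs ⟨h1, h2⟩
    rcases hs with hs | ⟨_, hs⟩ <;> omega
  have hind : Indep (⨆ s ∈ past, σ s) (⨆ s ∈ current, σ s) P :=
    indep_iSup_of_disjoint hle hS.indep_draws.iIndep hdisj
  have hmeas : ∀ {S : Set (ℕ × ℕ × Fin b)} (s : ℕ × ℕ × Fin b), s ∈ S →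
      Measurable[⨆ s ∈ S, σ s] fun ω => draws I G ω s.1 s.2.1 s.2.2 := fun {S} s hs =>
    Measurable.mono (comap_measurable _) (le_iSup₂_of_le s hs le_rfl) le_rfl
  rw [IndepFun_iff_Indep]
  refine indep_of_indep_of_le_left (indep_of_indep_of_le_right hind ?_) ?_
  · refine Measurable.comap_le (@measurable_pi_lambda _ _ _ (_) _ _ fun j => ?_)
    exact hmeas (τ, k, j) ⟨rfl, rfl⟩
  · refine Measurable.comap_le ?_
    have h1 := @measurable_outerIter d n b Ω (⨆ s ∈ past, σ s) f h γ ℓ m hf hp β (draws I G) x₀ τ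
      fun τ' hτ' k' j => hmeas (τ', k', j) (Or.inl hτ')
    have h2 := @measurable_innerIter d n b Ω (⨆ s ∈ past, σ s) f h γ ℓ hf hp (β τ)
      (fun ω => draws I G ω τ) _ h1 k fun k' hk' j => hmeas (τ, k', j) (Or.inr ⟨rfl, hk'⟩)
    exact @Measurable.prodMk _ (⨆ s ∈ past, σ s) _ _ _ _ _ _ h1 h2

/-- Conditioning on an independent variable: a bound for every frozen value of `X` can be
integrated. -/
theorem integral_le_of_indepFun [IsProbabilityMeasure P] {A B : Type*} [MeasurableSpace A]
    [MeasurableSpace B] {X : Ω → A} {Z : Ω → B} (hX : Measurable X) (hZ : Measurable Z)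
    (hind : IndepFun X Z P) {φ : A → B → ℝ} (hφ : Measurable fun p : A × B => φ p.1 p.2)
    (hint : Integrable (fun ω => φ (X ω) (Z ω)) P) {ψ : A → ℝ} (hψ : Measurable ψ)
    (hψi : Integrable (fun ω => ψ (X ω)) P) (hle : ∀ a, ∫ ω, φ a (Z ω) ∂P ≤ ψ a) :
    ∫ ω, φ (X ω) (Z ω) ∂P ≤ ∫ ω, ψ (X ω) ∂P := by
  have hmap := (indepFun_iff_map_prod_eq_prod_map_map hX.aemeasurable hZ.aemeasurable).1 hind
  have hXZ : Measurable fun ω => (X ω, Z ω) := hX.prodMk hZ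
  have := Measure.isProbabilityMeasure_map (μ := P) hX.aemeasurable
  have := Measure.isProbabilityMeasure_map (μ := P) hZ.aemeasurable
  have hint' : Integrable (fun p : A × B => φ p.1 p.2) ((P.map X).prod (P.map Z)) := by
    rw [← hmap, integrable_map_measure hφ.aestronglyMeasurable hXZ.aemeasurable]
    exact hint
  have h1 : ∫ ω, φ (X ω) (Z ω) ∂P = ∫ a, ∫ z, φ a z ∂(P.map Z) ∂(P.map X) := by
    rw [← integral_prod (fun p : A × B => φ p.1 p.2) hint', ← hmap,
      integral_map hXZ.aemeasurable hφ.aestronglyMeasurable]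
  rw [h1, ← integral_map (f := ψ) hX.aemeasurable hψ.aestronglyMeasurable]
  refine integral_mono hint'.integral_prod_left ?_ fun a => ?_
  · rw [integrable_map_measure hψ.aestronglyMeasurable hX.aemeasurable]
    exact hψi
  · have hφa : Measurable (φ a) := hφ.comp measurable_prodMk_left
    simp only
    rw [integral_map hZ.aemeasurable hφa.aestronglyMeasurable]
    exact hle a

end Independence

/-! ### The expected gap along the iterations -/

/-- The standing assumptions on the problem and on the parameters of the algorithm. -/
structure Setting {d n : ℕ} (f : Fin n → E d → ℝ) (h : E d → EReal) (L μ γ : ℝ) (ℓ m b : ℕ) :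
    Prop where
  n_pos : 0 < n
  b_pos : 0 < b
  m_pos : 0 < m
  one_le_ℓ : 1 ≤ ℓ
  ℓ_le : ℓ ≤ d
  L_pos : 0 < L
  μ_pos : 0 < μ
  γ_pos : 0 < γ
  smooth : IsSmoothFamily f L
  convex : IsConvexExt h
  proximable : IsProximable h
  exists_min : ∃ z, ∀ x, objective f h z ≤ objective f h x
  rpl : IsRPL f h γ μ
  stepsize_lt_smooth : γ < 1 / (4 * L)
  stepsize_lt_rate : γ < 2 / μ * (1 / (2 * m + 1))
  stepsize_lt_batch : γ < Real.sqrt (b * theta γ μ m) / (10 * m * L) * Real.sqrt (ℓ / d)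

namespace Setting

variable {d n : ℕ} {f : Fin n → E d → ℝ} {h : E d → EReal} {L μ γ : ℝ} {ℓ m b : ℕ}

theorem γμ_lt (S : Setting f h L μ γ ℓ m b) : γ * μ * (2 * m + 1) < 2 := by
  have h1 := S.stepsize_lt_rate
  have := S.μ_pos
  rw [div_mul_div_comm, mul_one, lt_div_iff₀ (by positivity)] at h1
  linarith

theorem rate_pos (S : Setting f h L μ γ ℓ m b) : 0 < rate γ μ := by
  have h1 := S.γμ_lt
  have h2 := mul_pos S.γ_pos S.μ_pos
  have h3 : 0 ≤ γ * μ * m := by positivity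
  rw [rate]; linarith

theorem rate_lt_one (S : Setting f h L μ γ ℓ m b) : rate γ μ < 1 := by
  have h2 := mul_pos S.γ_pos S.μ_pos
  rw [rate]; linarith

/-- Bernoulli's inequality gives `α ^ m ≥ 1 - m γ μ / 2`, which already exceeds `θ`. -/
theorem theta_le_rate_pow (S : Setting f h L μ γ ℓ m b) : theta γ μ m ≤ rate γ μ ^ m := by
  have h2 := mul_pos S.γ_pos S.μ_pos
  have h0 := S.rate_pos
  rw [rate] at h0
  have h1 := one_add_mul_le_pow (a := -(γ * μ / 2)) (by linarith) m
  have h3 : 0 ≤ γ * μ * m := by positivity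
  rw [theta, rate, sub_eq_add_neg 1 (γ * μ / 2)]
  linarith

/-- The stepsize condition in the form in which it absorbs the variance of the batches. -/
theorem variance_absorbed (S : Setting f h L μ γ ℓ m b) :
    γ / 2 * (3 * (1 / b * ((d : ℝ) / ℓ * L ^ 2))) * m ^ 2 ≤ 3 / (8 * γ) * rate γ μ ^ m := by
  have hb : (0 : ℝ) < b := by exact_mod_cast S.b_pos
  have hm : (0 : ℝ) < m := by exact_mod_cast S.m_pos
  have hℓ : (0 : ℝ) < ℓ := by exact_mod_cast S.one_le_ℓ
  have hd : (0 : ℝ) < d := by exact_mod_cast S.one_le_ℓ.trans S.ℓ_le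
  have hL := S.L_pos
  have hγ := S.γ_pos
  have hθ : 0 ≤ theta γ μ m := by
    have := S.γμ_lt
    rw [theta]; linarith
  have h1 : γ ^ 2 ≤ (Real.sqrt (b * theta γ μ m) / (10 * m * L) * Real.sqrt (ℓ / d)) ^ 2 := by
    have := S.stepsize_lt_batch.le
    gcongr
  rw [mul_pow, div_pow, Real.sq_sqrt (by positivity), Real.sq_sqrt (by positivity)] at h1
  have h2 : γ ^ 2 ≤ (b * rate γ μ ^ m) / (10 * m * L) ^ 2 * (ℓ / d) := by
    refine h1.trans ?_
    gcongr
    exact S.theta_le_rate_pow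
  have h3 : γ ^ 2 * (100 * m ^ 2 * L ^ 2 * d / (b * ℓ)) ≤ rate γ μ ^ m := by
    calc _ ≤ (b * rate γ μ ^ m) / (10 * m * L) ^ 2 * (ℓ / d)
          * (100 * m ^ 2 * L ^ 2 * d / (b * ℓ)) := by gcongr
      _ = rate γ μ ^ m := by field_simp; norm_num
  -- The constant `10` in the stepsize condition leaves a factor `25` to spare.
  have h4 : γ / 2 * (3 * (1 / b * ((d : ℝ) / ℓ * L ^ 2))) * m ^ 2
      = 3 / (8 * γ) * (γ ^ 2 * (100 * m ^ 2 * L ^ 2 * d / (b * ℓ)) / 25) := by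
    field_simp; norm_num
  rw [h4]
  gcongr
  have : 0 ≤ γ ^ 2 * (100 * m ^ 2 * L ^ 2 * d / (b * ℓ)) := by positivity
  linarith

theorem continuous_component (S : Setting f h L μ γ ℓ m b) (i : Fin n) : Continuous (f i) :=
  (S.smooth i).1.continuous

end Setting

/-- The real recursion behind the inner loop. -/
theorem le_of_inner_recursion {α A B c : ℝ} {a s r : ℕ → ℝ} {m : ℕ} (hα0 : 0 < α) (hα1 : α < 1)
    (hA : 0 ≤ A) (hAm : A * m ^ 2 ≤ c * α ^ m) (hs : ∀ k, 0 ≤ s k)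
    (hr : ∀ k, r k ≤ k * ∑ j ∈ Finset.range k, s j)
    (ha : ∀ k, a (k + 1) ≤ α * a k - c * s k + A * r k + B) :
    a m ≤ α ^ m * a 0 + B * ∑ k ∈ Finset.range m, α ^ k := by
  have hc : 0 ≤ c := nonneg_of_mul_nonneg_left ((by positivity : 0 ≤ A * (m : ℝ) ^ 2).trans hAm)
    (by positivity)
  have hS : ∀ k, 0 ≤ ∑ j ∈ Finset.range k, s j := fun k => Finset.sum_nonneg fun j _ => hs j
  -- The invariant keeps a reserve of past squared steps with coefficient `c α ^ k - A m k`. It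
  -- shrinks by the contraction and by `A m` per step, and the hypothesis on `A * m ^ 2` makes it
  -- nonnegative at `k = m`, where it is dropped.
  have key : ∀ k ≤ m, a k ≤ α ^ k * a 0 + B * ∑ j ∈ Finset.range k, α ^ j
      - (c * α ^ k - A * m * k) * ∑ j ∈ Finset.range k, s j := by
    intro k
    induction k with
    | zero => intro _; simp
    | succ k ih =>
      intro hk
      have h1 := ih (by omega)
      have hkm : (k : ℝ) ≤ m := by exact_mod_cast (by omega : k ≤ m)
      have h2 : A * r k ≤ A * m * ∑ j ∈ Finset.range k, s j := by
        rw [mul_assoc]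
        gcongr
        exact (hr k).trans (by gcongr; exact hS k)
      have h3 := mul_le_mul_of_nonneg_left h1 hα0.le
      rw [Finset.sum_range_succ s, geom_sum_succ, pow_succ]
      push_cast
      have h4 : 0 ≤ (1 - α) * (A * m * k * ∑ j ∈ Finset.range k, s j) :=
        mul_nonneg (by linarith) (mul_nonneg (by positivity) (hS k))
      have h5 : (c * (α ^ k * α) - A * m * (k + 1)) * s k ≤ c * s k := by
        refine mul_le_mul_of_nonneg_right ?_ (hs k)
        have h6 : c * (α ^ k * α) ≤ c * 1 := by
          gcongr
          exact mul_le_one₀ (pow_le_one₀ hα0.le hα1.le) hα0.le hα1.le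
        have h7 : 0 ≤ A * m * (k + 1) := by positivity
        linarith
      have h8 := ha k
      nlinarith
  refine (key m le_rfl).trans ?_
  have : 0 ≤ (c * α ^ m - A * m * m) * ∑ j ∈ Finset.range m, s j :=
    mul_nonneg (by nlinarith) (hS m)
  linarith

/-! ### Boundedness of the iterates and one inner step in expectation -/

section Expectation

variable {d n b : ℕ} {Ω : Type*} [MeasurableSpace Ω] {f : Fin n → E d → ℝ} {h : E d → EReal}
  {L μ γ β : ℝ} {ℓ m : ℕ}

/-- A random point, bounded and with a bounded measurable gap. -/
structure IsRegular (f : Fin n → E d → ℝ) (h : E d → EReal) (X : Ω → E d) : Prop where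
  measurable : Measurable X
  ne_top : ∀ ω, h (X ω) ≠ ⊤
  measurable_gap : Measurable fun ω => gap f h (X ω)
  bounded : ∃ R, ∀ ω, ‖X ω‖ ≤ R ∧ gap f h (X ω) ≤ R

/-- One inner step from random points `X₀` and `X` with random batch `ξ`. -/
noncomputable def stepFrom (f : Fin n → E d → ℝ) (h : E d → EReal) (γ : ℝ) (ℓ : ℕ) (β : ℝ)
    (ξ : Ω → Fin b → Fin n × OGroup d) (X₀ X : Ω → E d) (ω : Ω) : E d :=
  prox h γ (X ω - γ • searchDir f ℓ β (ξ ω) (X₀ ω) (X ω))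

theorem norm_sq_searchDir_sub_le_of_dist (S : Setting f h L μ γ ℓ m b) (hβ : 0 < β)
    (ξ : Fin b → Fin n × OGroup d) (x₀ x : E d) :
    ‖searchDir f ℓ β ξ x₀ x - gradient (avg f) x‖ ^ 2
      ≤ 3 * (((d : ℝ) / ℓ + 1) * L * ‖x - x₀‖) ^ 2 + biasConst L d ℓ * β ^ 2 := by
  refine (norm_sq_searchDir_sub_le S.n_pos S.b_pos S.one_le_ℓ S.ℓ_le S.smooth hβ ξ x₀ x).trans ?_
  gcongr
  exact norm_sketchDir_sub_le S.n_pos S.b_pos S.smooth ξ x₀ x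

theorem IsRegular.norm_sub_le {X₀ X : Ω → E d} (hX₀ : IsRegular f h X₀) (hX : IsRegular f h X) :
    ∃ R, ∀ ω, ‖X ω - X₀ ω‖ ≤ R := by
  obtain ⟨R₀, h₀⟩ := hX₀.bounded
  obtain ⟨R, h₁⟩ := hX.bounded
  exact ⟨R + R₀, fun ω => (_root_.norm_sub_le _ _).trans (add_le_add (h₁ ω).1 (h₀ ω).1)⟩

theorem IsRegular.norm_sq_searchDir_le (S : Setting f h L μ γ ℓ m b) (hβ : 0 < β)
    {ξ : Ω → Fin b → Fin n × OGroup d} {X₀ X : Ω → E d} (hX₀ : IsRegular f h X₀)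
    (hX : IsRegular f h X) :
    ∃ R, ∀ ω, ‖searchDir f ℓ β (ξ ω) (X₀ ω) (X ω) - gradient (avg f) (X ω)‖ ^ 2 ≤ R := by
  obtain ⟨R, hR⟩ := hX₀.norm_sub_le hX
  have hL := S.L_pos
  exact ⟨3 * (((d : ℝ) / ℓ + 1) * L * R) ^ 2 + biasConst L d ℓ * β ^ 2, fun ω =>
    (norm_sq_searchDir_sub_le_of_dist S hβ (ξ ω) (X₀ ω) (X ω)).trans
    (by have := hR ω; gcongr)⟩

theorem Setting.gap_stepFrom_le (S : Setting f h L μ γ ℓ m b)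
    {ξ : Ω → Fin b → Fin n × OGroup d} {X₀ X : Ω → E d} (hX : IsRegular f h X) (ω : Ω) :
    gap f h (stepFrom f h γ ℓ β ξ X₀ X ω) ≤ rate γ μ * gap f h (X ω)
      - 3 / (8 * γ) * ‖stepFrom f h γ ℓ β ξ X₀ X ω - X ω‖ ^ 2
      + γ / 2 * ‖searchDir f ℓ β (ξ ω) (X₀ ω) (X ω) - gradient (avg f) (X ω)‖ ^ 2 :=
  gap_step_le S.convex S.proximable S.γ_pos S.n_pos S.smooth S.stepsize_lt_smooth S.L_pos S.rpl
    (hX.ne_top ω) _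

theorem Setting.gap_nonneg (S : Setting f h L μ γ ℓ m b) {x : E d} (hx : h x ≠ ⊤) :
    0 ≤ gap f h x :=
  let ⟨_, hz⟩ := S.exists_min
  VRSZD.gap_nonneg S.convex hz hx

/-- Since the new gap is nonnegative, the one-step inequality bounds both it and the squared
displacement, uniformly in the outcome. Measurability of the gap rests on continuity of `h` along
proximal points. -/
theorem IsRegular.stepFrom (S : Setting f h L μ γ ℓ m b) (hβ : 0 < β)
    {ξ : Ω → Fin b → Fin n × OGroup d} {X₀ X : Ω → E d} (hξ : ∀ j, Measurable fun ω => ξ ω j)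
    (hX₀ : IsRegular f h X₀) (hX : IsRegular f h X) :
    IsRegular f h (stepFrom f h γ ℓ β ξ X₀ X) := by
  have hne : ∀ ω, h (VRSZD.stepFrom f h γ ℓ β ξ X₀ X ω) ≠ ⊤ := fun ω =>
    prox_ne_top S.proximable S.γ_pos (hX.ne_top ω) _
  -- Continuity of the proximal operator needs a point where `h` is finite; any value of `X`
  -- provides one.
  rcases isEmpty_or_nonempty Ω with hΩ | ⟨⟨ω₀⟩⟩
  · exact ⟨measurable_of_empty _, hne, measurable_of_empty _, 0, fun ω => hΩ.elim ω⟩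
  have hu : Measurable fun ω => X ω - γ • searchDir f ℓ β (ξ ω) (X₀ ω) (X ω) :=
    hX.measurable.sub ((measurable_searchDir S.continuous_component ℓ β hξ hX₀.measurable
      hX.measurable).const_smul γ)
  have hm : Measurable (VRSZD.stepFrom f h γ ℓ β ξ X₀ X) :=
    (continuous_prox S.convex S.proximable S.γ_pos (hX.ne_top ω₀)).measurable.comp hu
  refine ⟨hm, hne, ?_, ?_⟩
  · have h1 := (continuous_toReal_prox S.convex S.proximable S.γ_pos
      (hX.ne_top ω₀)).measurable.comp hu
    have h2 : Measurable fun ω => avg f (VRSZD.stepFrom f h γ ℓ β ξ X₀ X ω) :=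
      S.smooth.differentiable_avg.continuous.measurable.comp hm
    rw [show (fun ω => gap f h (VRSZD.stepFrom f h γ ℓ β ξ X₀ X ω)) = _ from
      funext fun ω => gap_eq S.convex (hne ω)]
    exact (h2.add h1).sub_const (minValue f h)
  · obtain ⟨R, hR⟩ := hX.bounded
    obtain ⟨R', hR'⟩ := IsRegular.norm_sq_searchDir_le (ξ := ξ) S hβ hX₀ hX
    have hγ := S.γ_pos
    have hα := S.rate_pos
    set K := rate γ μ * R + γ / 2 * R' with hK
    have hstep : ∀ ω, gap f h (VRSZD.stepFrom f h γ ℓ β ξ X₀ X ω)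
        + 3 / (8 * γ) * ‖VRSZD.stepFrom f h γ ℓ β ξ X₀ X ω - X ω‖ ^ 2 ≤ K := fun ω => by
      have h1 := S.gap_stepFrom_le (β := β) (ξ := ξ) (X₀ := X₀) hX ω
      have h2 := mul_le_mul_of_nonneg_left (hR ω).2 hα.le
      have h3 := mul_le_mul_of_nonneg_left (hR' ω) (by positivity : 0 ≤ γ / 2)
      linarith
    -- `K` bounds the new gap; the other entry bounds the norm through `‖D‖ ≤ ‖D‖ ^ 2 + 1`.
    refine ⟨max K (R + (K / (3 / (8 * γ)) + 1)), fun ω => ⟨le_max_of_le_right ?_,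
      le_max_of_le_left ?_⟩⟩
    · have h1 := hstep ω
      have h2 := S.gap_nonneg (hne ω)
      set D := VRSZD.stepFrom f h γ ℓ β ξ X₀ X ω - X ω with hD
      have h3 : ‖D‖ ^ 2 ≤ K / (3 / (8 * γ)) := by
        rw [le_div_iff₀ (by positivity)]; linarith
      have h4 : VRSZD.stepFrom f h γ ℓ β ξ X₀ X ω = X ω + D := by rw [hD]; abel
      have h5 := norm_add_le (X ω) D
      rw [h4]
      nlinarith [(hR ω).1, sq_nonneg (‖D‖ - 1), norm_nonneg D]
    · have h1 := hstep ω
      have h2 : 0 ≤ 3 / (8 * γ) * ‖VRSZD.stepFrom f h γ ℓ β ξ X₀ X ω - X ω‖ ^ 2 := by positivity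
      linarith

variable {P : Measure Ω} [IsProbabilityMeasure P]

theorem IsRegular.integrable_gap (S : Setting f h L μ γ ℓ m b) {X : Ω → E d}
    (hX : IsRegular f h X) : Integrable (fun ω => gap f h (X ω)) P := by
  obtain ⟨R, hR⟩ := hX.bounded
  refine Integrable.of_bound hX.measurable_gap.aestronglyMeasurable R (ae_of_all _ fun ω => ?_)
  rw [Real.norm_of_nonneg (S.gap_nonneg (hX.ne_top ω))]
  exact (hR ω).2

theorem IsRegular.integrable_norm_sub_sq {X₀ X : Ω → E d} (hX₀ : IsRegular f h X₀)
    (hX : IsRegular f h X) : Integrable (fun ω => ‖X ω - X₀ ω‖ ^ 2) P := by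
  obtain ⟨R, hR⟩ := hX₀.norm_sub_le hX
  refine Integrable.of_bound
    ((hX.measurable.sub hX₀.measurable).norm.pow_const 2).aestronglyMeasurable (R ^ 2)
    (ae_of_all _ fun ω => ?_)
  rw [norm_pow, norm_norm]
  have := hR ω
  gcongr

/-- The mean squared error of the search direction at deterministic points. -/
theorem integral_norm_sq_searchDir_sub_le (S : Setting f h L μ γ ℓ m b) (hβ : 0 < β)
    {I : Fin b → Ω → Fin n} {G : Fin b → Ω → OGroup d} (hD : ∀ j, IsDraw P (I j) (G j))
    (hind : iIndepFun (fun j ω => (I j ω, G j ω)) P) (x₀ x : E d) :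
    ∫ ω, ‖searchDir f ℓ β (fun j => (I j ω, G j ω)) x₀ x - gradient (avg f) x‖ ^ 2 ∂P
      ≤ 3 * (1 / b * ((d : ℝ) / ℓ * L ^ 2)) * ‖x - x₀‖ ^ 2 + biasConst L d ℓ * β ^ 2 := by
  have hξ : ∀ j, Measurable fun ω => (I j ω, G j ω) := fun j =>
    (hD j).measurable_index.prodMk (hD j).measurable_matrix
  have hbatch := integral_norm_sq_batch_le S.one_le_ℓ S.ℓ_le
    (w := fun i => gradient (f i) x - gradient (f i) x₀) (fun i => (S.smooth i).2 x x₀)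
    S.n_pos S.b_pos hD hind
  have hmean : (1 / (n : ℝ)) • ∑ i, (gradient (f i) x - gradient (f i) x₀)
      = gradient (avg f) x - gradient (avg f) x₀ := by
    rw [gradient_avg fun i => (S.smooth i).1, gradient_avg fun i => (S.smooth i).1,
      Finset.sum_sub_distrib, smul_sub]
  rw [hmean] at hbatch
  have hsk : Measurable fun ω => (1 / (b : ℝ)) • ∑ j,
      sketch ℓ (G j ω) (gradient (f (I j ω)) x - gradient (f (I j ω)) x₀) :=
    (Finset.measurable_sum _ fun j _ => (measurable_sketch_draw ℓ
      fun i => gradient (f i) x - gradient (f i) x₀).comp (hξ j)).const_smul (1 / (b : ℝ))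
  have hint1 : Integrable (fun ω => ‖sketchDir f ℓ (fun j => (I j ω, G j ω)) x₀ x
      - (gradient (avg f) x - gradient (avg f) x₀)‖ ^ 2) P := by
    refine Integrable.of_bound ((hsk.sub_const _).norm.pow_const 2).aestronglyMeasurable
      ((((d : ℝ) / ℓ + 1) * L * ‖x - x₀‖) ^ 2) (ae_of_all _ fun ω => ?_)
    rw [norm_pow, norm_norm]
    gcongr
    exact norm_sketchDir_sub_le S.n_pos S.b_pos S.smooth _ x₀ x
  have hint2 : Integrable (fun ω => ‖searchDir f ℓ β (fun j => (I j ω, G j ω)) x₀ x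
      - gradient (avg f) x‖ ^ 2) P := by
    refine Integrable.of_bound (((measurable_searchDir S.continuous_component ℓ β hξ
      measurable_const measurable_const).sub_const _).norm.pow_const 2).aestronglyMeasurable
      (3 * (((d : ℝ) / ℓ + 1) * L * ‖x - x₀‖) ^ 2 + biasConst L d ℓ * β ^ 2)
      (ae_of_all _ fun ω => ?_)
    rw [norm_pow, norm_norm]
    exact norm_sq_searchDir_sub_le_of_dist S hβ _ x₀ x
  calc _ ≤ ∫ ω, (3 * ‖sketchDir f ℓ (fun j => (I j ω, G j ω)) x₀ x
        - (gradient (avg f) x - gradient (avg f) x₀)‖ ^ 2 + biasConst L d ℓ * β ^ 2) ∂P :=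
        integral_mono hint2 ((hint1.const_mul 3).add (integrable_const _)) fun ω =>
          norm_sq_searchDir_sub_le S.n_pos S.b_pos S.one_le_ℓ S.ℓ_le S.smooth hβ _ x₀ x
    _ = 3 * ∫ ω, ‖sketchDir f ℓ (fun j => (I j ω, G j ω)) x₀ x
        - (gradient (avg f) x - gradient (avg f) x₀)‖ ^ 2 ∂P + biasConst L d ℓ * β ^ 2 := by
        rw [integral_add (hint1.const_mul 3) (integrable_const _), integral_const_mul]
        simp
    _ ≤ 3 * (1 / b * ((d : ℝ) / ℓ * (L * ‖x - x₀‖) ^ 2)) + biasConst L d ℓ * β ^ 2 := by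
        gcongr; exact hbatch
    _ = _ := by ring

/-- The expected decrease of the gap in one inner step. -/
theorem integral_gap_stepFrom_le (S : Setting f h L μ γ ℓ m b) (hβ : 0 < β)
    {I : Fin b → Ω → Fin n} {G : Fin b → Ω → OGroup d} (hD : ∀ j, IsDraw P (I j) (G j))
    (hind : iIndepFun (fun j ω => (I j ω, G j ω)) P) {X₀ X : Ω → E d} (hX₀ : IsRegular f h X₀)
    (hX : IsRegular f h X)
    (hindX : IndepFun (fun ω => (X₀ ω, X ω)) (fun ω j => (I j ω, G j ω)) P) :
    ∫ ω, gap f h (stepFrom f h γ ℓ β (fun ω j => (I j ω, G j ω)) X₀ X ω) ∂P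
      ≤ rate γ μ * ∫ ω, gap f h (X ω) ∂P
        - 3 / (8 * γ)
          * ∫ ω, ‖stepFrom f h γ ℓ β (fun ω j => (I j ω, G j ω)) X₀ X ω - X ω‖ ^ 2 ∂P
        + γ / 2 * (3 * (1 / b * ((d : ℝ) / ℓ * L ^ 2))) * ∫ ω, ‖X ω - X₀ ω‖ ^ 2 ∂P
        + γ / 2 * (biasConst L d ℓ * β ^ 2) := by
  have hξ : ∀ j, Measurable fun ω => (I j ω, G j ω) := fun j =>
    (hD j).measurable_index.prodMk (hD j).measurable_matrix
  set ξ : Ω → Fin b → Fin n × OGroup d := fun ω j => (I j ω, G j ω) with hξdef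
  have hX' := IsRegular.stepFrom S hβ hξ hX₀ hX
  have hgrad := (S.smooth.continuous_gradient_avg S.n_pos S.L_pos).measurable
  have herr : Integrable (fun ω => ‖searchDir f ℓ β (ξ ω) (X₀ ω) (X ω)
      - gradient (avg f) (X ω)‖ ^ 2) P := by
    obtain ⟨R, hR⟩ := IsRegular.norm_sq_searchDir_le (ξ := ξ) S hβ hX₀ hX
    refine Integrable.of_bound (((measurable_searchDir S.continuous_component ℓ β hξ hX₀.measurable
      hX.measurable).sub (hgrad.comp hX.measurable)).norm.pow_const 2).aestronglyMeasurable R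
      (ae_of_all _ fun ω => ?_)
    rw [norm_pow, norm_norm]
    exact hR ω
  have hdist := hX₀.integrable_norm_sub_sq (P := P) hX
  -- Freeze the two iterates, use the variance bound at deterministic points, then integrate over
  -- their law.
  have hvar : ∫ ω, ‖searchDir f ℓ β (ξ ω) (X₀ ω) (X ω) - gradient (avg f) (X ω)‖ ^ 2 ∂P
      ≤ ∫ ω, (3 * (1 / b * ((d : ℝ) / ℓ * L ^ 2)) * ‖X ω - X₀ ω‖ ^ 2
        + biasConst L d ℓ * β ^ 2) ∂P := by
    refine integral_le_of_indepFun (hX₀.measurable.prodMk hX.measurable)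
      (measurable_pi_lambda _ hξ) hindX
      (φ := fun p z => ‖searchDir f ℓ β z p.1 p.2 - gradient (avg f) p.2‖ ^ 2)
      (ψ := fun p => 3 * (1 / b * ((d : ℝ) / ℓ * L ^ 2)) * ‖p.2 - p.1‖ ^ 2
        + biasConst L d ℓ * β ^ 2) ?_ herr ?_ ?_ ?_
    · have h1 : Measurable fun q : (E d × E d) × (Fin b → Fin n × OGroup d) =>
          searchDir f ℓ β q.2 q.1.1 q.1.2 :=
        measurable_searchDir S.continuous_component ℓ β
          (fun j => (measurable_pi_apply j).comp measurable_snd)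
          (measurable_fst.comp measurable_fst) (measurable_snd.comp measurable_fst)
      exact (h1.sub (hgrad.comp (measurable_snd.comp measurable_fst))).norm.pow_const 2
    · fun_prop
    · exact (hdist.const_mul _).add (integrable_const _)
    · exact fun p => integral_norm_sq_searchDir_sub_le S hβ hD hind p.1 p.2
  rw [integral_add (hdist.const_mul _) (integrable_const _), integral_const_mul] at hvar
  simp only [integral_const, probReal_univ, one_smul] at hvar
  have hg := hX.integrable_gap (P := P) S
  have hs := hX.integrable_norm_sub_sq (P := P) hX'
  have hγ := S.γ_pos
  have hgs : Integrable (fun ω => rate γ μ * gap f h (X ω)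
      - 3 / (8 * γ) * ‖stepFrom f h γ ℓ β ξ X₀ X ω - X ω‖ ^ 2) P :=
    (hg.const_mul _).sub (hs.const_mul _)
  calc _ ≤ ∫ ω, (rate γ μ * gap f h (X ω)
          - 3 / (8 * γ) * ‖stepFrom f h γ ℓ β ξ X₀ X ω - X ω‖ ^ 2
          + γ / 2 * ‖searchDir f ℓ β (ξ ω) (X₀ ω) (X ω) - gradient (avg f) (X ω)‖ ^ 2) ∂P :=
        integral_mono (hX'.integrable_gap S)
          (hgs.add (herr.const_mul _))
          fun ω => S.gap_stepFrom_le hX ω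
    _ = rate γ μ * ∫ ω, gap f h (X ω) ∂P
          - 3 / (8 * γ) * ∫ ω, ‖stepFrom f h γ ℓ β ξ X₀ X ω - X ω‖ ^ 2 ∂P
          + γ / 2 * ∫ ω, ‖searchDir f ℓ β (ξ ω) (X₀ ω) (X ω)
            - gradient (avg f) (X ω)‖ ^ 2 ∂P := by
        rw [integral_add hgs (herr.const_mul _),
          integral_sub (hg.const_mul _) (hs.const_mul _), integral_const_mul, integral_const_mul,
          integral_const_mul]
    _ ≤ _ := by
        have := mul_le_mul_of_nonneg_left hvar (by positivity : 0 ≤ γ / 2)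
        linarith

end Expectation

/-! ### One outer iteration in expectation, and its unrolling -/

section Outer

variable {d n b : ℕ} {Ω : Type*} [MeasurableSpace Ω] {f : Fin n → E d → ℝ} {h : E d → EReal}
  {L μ γ : ℝ} {ℓ m : ℕ} {I : ℕ → ℕ → Fin b → Ω → Fin n} {G : ℕ → ℕ → Fin b → Ω → OGroup d}
  {x₀ : E d} {β : ℕ → ℝ} {P : Measure Ω}

theorem isRegular_const (hx₀ : h x₀ ≠ ⊤) : IsRegular f h fun _ : Ω => x₀ :=
  ⟨measurable_const, fun _ => hx₀, measurable_const, max ‖x₀‖ (gap f h x₀),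
    fun _ => ⟨le_max_left _ _, le_max_right _ _⟩⟩

theorem IsRegular.innerIter (S : Setting f h L μ γ ℓ m b) (hS : IsSampling P I G) (τ : ℕ)
    (hβ : 0 < β τ) {X₀ : Ω → E d} (hX₀ : IsRegular f h X₀) (k : ℕ) :
    IsRegular f h fun ω => innerIter f h γ ℓ (β τ) (draws I G ω τ) (X₀ ω) k := by
  induction k with
  | zero => exact hX₀
  | succ k ih =>
    exact IsRegular.stepFrom (ξ := fun ω => draws I G ω τ k) S hβ
      (fun j => hS.measurable_draws τ k j) hX₀ ih

theorem isRegular_outerIter (S : Setting f h L μ γ ℓ m b) (hS : IsSampling P I G)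
    (hβ : ∀ τ, 0 < β τ) (hx₀ : h x₀ ≠ ⊤) (τ : ℕ) :
    IsRegular f h fun ω => outerIter f h γ ℓ m β (draws I G ω) x₀ τ := by
  induction τ with
  | zero => exact isRegular_const hx₀
  | succ τ ih => exact IsRegular.innerIter S hS τ (hβ τ) ih m

/-- Telescoping and Cauchy–Schwarz. This converts the variance, measured from the outer iterate,
into step lengths that the descent can absorb. -/
theorem norm_sub_sq_le_mul_sum {V : Type*} [SeminormedAddCommGroup V] (u : ℕ → V) (k : ℕ) :
    ‖u k - u 0‖ ^ 2 ≤ k * ∑ j ∈ Finset.range k, ‖u (j + 1) - u j‖ ^ 2 := by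
  rw [← Finset.sum_range_sub u k]
  calc _ ≤ (∑ j ∈ Finset.range k, ‖u (j + 1) - u j‖) ^ 2 := by gcongr; exact norm_sum_le _ _
    _ ≤ _ := by simpa using sq_sum_le_card_mul_sum_sq (s := Finset.range k)
                  (f := fun j => ‖u (j + 1) - u j‖)

theorem biasConst_eq (S : Setting f h L μ γ ℓ m b) : biasConst L d ℓ = μ * errConst L μ d ℓ := by
  have : μ * (2 / μ) = 2 := mul_div_cancel₀ 2 S.μ_pos.ne'
  rw [biasConst, errConst, ← mul_assoc, this]; ring

/-- The expected contraction of the gap in one outer iteration. -/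
theorem integral_gap_outerIter_succ_le [IsProbabilityMeasure P] (S : Setting f h L μ γ ℓ m b)
    (hS : IsSampling P I G) (hβ : ∀ τ, 0 < β τ) (hx₀ : h x₀ ≠ ⊤) (τ : ℕ) :
    ∫ ω, gap f h (outerIter f h γ ℓ m β (draws I G ω) x₀ (τ + 1)) ∂P
      ≤ rate γ μ ^ m * ∫ ω, gap f h (outerIter f h γ ℓ m β (draws I G ω) x₀ τ) ∂P
        + (1 - rate γ μ ^ m) * (errConst L μ d ℓ * β τ ^ 2) := by
  set X₀ : Ω → E d := fun ω => outerIter f h γ ℓ m β (draws I G ω) x₀ τ with hX₀def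
  set X : ℕ → Ω → E d := fun k ω =>
    innerIter f h γ ℓ (β τ) (draws I G ω τ) (X₀ ω) k with hXdef
  have hX₀ : IsRegular f h X₀ := isRegular_outerIter S hS hβ hx₀ τ
  have hX : ∀ k, IsRegular f h (X k) := IsRegular.innerIter S hS τ (hβ τ) hX₀
  have hp : Continuous (prox h γ) := continuous_prox S.convex S.proximable S.γ_pos hx₀
  have hγ := S.γ_pos
  have hγμ := mul_pos S.γ_pos S.μ_pos
  have hs : ∀ k, Integrable (fun ω => ‖X (k + 1) ω - X k ω‖ ^ 2) P := fun k =>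
    (hX k).integrable_norm_sub_sq (hX (k + 1))
  have key := le_of_inner_recursion (α := rate γ μ) (c := 3 / (8 * γ)) (m := m)
    (A := γ / 2 * (3 * (1 / b * ((d : ℝ) / ℓ * L ^ 2))))
    (B := γ / 2 * (biasConst L d ℓ * β τ ^ 2))
    (a := fun k => ∫ ω, gap f h (X k ω) ∂P)
    (s := fun k => ∫ ω, ‖X (k + 1) ω - X k ω‖ ^ 2 ∂P)
    (r := fun k => ∫ ω, ‖X k ω - X₀ ω‖ ^ 2 ∂P) S.rate_pos S.rate_lt_one (by positivity)
    S.variance_absorbed (fun k => integral_nonneg fun ω => by positivity)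
    (fun k => by
      rw [← integral_finsetSum _ fun j _ => hs j, ← integral_const_mul]
      exact integral_mono (hX₀.integrable_norm_sub_sq (hX k))
        ((integrable_finsetSum _ fun j _ => hs j).const_mul _)
        fun ω => norm_sub_sq_le_mul_sum (fun k => X k ω) k)
    (fun k => integral_gap_stepFrom_le S (hβ τ) (fun j => hS.isDraw τ k j)
      (hS.iIndepFun_batch τ k) hX₀ (hX k)
      (hS.indepFun_iterates (fun i => S.continuous_component i) hp β x₀ τ k))
  refine key.trans (le_of_eq ?_)
  -- As `1 - α = γ μ / 2` and `biasConst` is `μ` times `errConst`, the accumulated error is exactly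
  -- `(1 - α ^ m) * (errConst * β ^ 2)`.
  have hgeom := mul_neg_geom_sum (rate γ μ) m
  have h1 : 1 - rate γ μ = γ * μ / 2 := by rw [rate]; ring
  rw [← hgeom, h1, biasConst_eq S]
  change rate γ μ ^ m * ∫ ω, gap f h (X₀ ω) ∂P + _ = _
  ring

theorem expectedGapLE_outerIter [IsProbabilityMeasure P] (S : Setting f h L μ γ ℓ m b)
    (hS : IsSampling P I G) (hβ : ∀ τ, 0 < β τ) (hx₀ : h x₀ ≠ ⊤) (τ : ℕ) {B : ℝ}
    (hB : ∫ ω, gap f h (outerIter f h γ ℓ m β (draws I G ω) x₀ τ) ∂P ≤ B) :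
    ExpectedGapLE P f h (fun ω => outerIter f h γ ℓ m β (draws I G ω) x₀ τ) B :=
  have hX := isRegular_outerIter S hS hβ hx₀ τ
  ⟨ae_of_all _ fun ω => objective_ne_top_iff.2 (hX.ne_top ω), hX.integrable_gap S, hB⟩

theorem errConst_pos (S : Setting f h L μ γ ℓ m b) : 0 < errConst L μ d ℓ := by
  have h1 := S.L_pos
  have h2 := S.μ_pos
  have h3 : (0 : ℝ) < ℓ := by exact_mod_cast S.one_le_ℓ
  have h4 : (0 : ℝ) < d := by exact_mod_cast S.one_le_ℓ.trans S.ℓ_le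
  rw [errConst]; positivity

/-- The expected gap for discretization parameters that decrease geometrically. -/
theorem integral_gap_le_of_geometric [IsProbabilityMeasure P] (S : Setting f h L μ γ ℓ m b)
    (hS : IsSampling P I G) (hβ : ∀ τ, 0 < β τ) (hx₀ : h x₀ ≠ ⊤) {η : ℕ → ℝ}
    (hη : ∀ τ, β τ ^ 2 = rate γ μ ^ (m * (τ + 1)) * η τ ^ 2) (τ : ℕ) :
    ∫ ω, gap f h (outerIter f h γ ℓ m β (draws I G ω) x₀ τ) ∂P
      ≤ rate γ μ ^ (m * τ)
        * (gap f h x₀ + errConst L μ d ℓ * ∑ t ∈ Finset.range τ, η t ^ 2) := by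
  have hα := S.rate_pos
  have hE := errConst_pos S
  induction τ with
  | zero => simp [outerIter]
  | succ τ ih =>
    have h1 := integral_gap_outerIter_succ_le S hS hβ hx₀ τ
    have h2 := mul_le_mul_of_nonneg_left ih (by positivity : 0 ≤ rate γ μ ^ m)
    -- Dropping the factor `1 - α ^ m` leaves an error that already carries the weight `α ^ (m (τ +
    -- 1))` of the new iterate.
    have h3 : (1 - rate γ μ ^ m) * (errConst L μ d ℓ * β τ ^ 2) ≤ errConst L μ d ℓ * β τ ^ 2 := by
      have : 0 ≤ rate γ μ ^ m * (errConst L μ d ℓ * β τ ^ 2) := by positivity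
      linarith
    rw [hη] at h3 h1
    rw [Finset.sum_range_succ]
    have h4 : rate γ μ ^ (m * (τ + 1)) = rate γ μ ^ m * rate γ μ ^ (m * τ) := by
      rw [← pow_add]; ring_nf
    rw [h4] at h1 h3 ⊢
    linarith

/-- The expected gap for a constant discretization parameter. -/
theorem integral_gap_le_of_const [IsProbabilityMeasure P] (S : Setting f h L μ γ ℓ m b)
    (hS : IsSampling P I G) {β : ℝ} (hβ : 0 < β) (hx₀ : h x₀ ≠ ⊤) (τ : ℕ) :
    ∫ ω, gap f h (outerIter f h γ ℓ m (fun _ => β) (draws I G ω) x₀ τ) ∂P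
      ≤ rate γ μ ^ (m * τ) * gap f h x₀ + errConst L μ d ℓ * β ^ 2 := by
  have hα := S.rate_pos
  have hE := errConst_pos S
  induction τ with
  | zero =>
    simp only [outerIter, integral_const, probReal_univ, one_smul, mul_zero, pow_zero, one_mul]
    have : 0 ≤ errConst L μ d ℓ * β ^ 2 := by positivity
    linarith
  | succ τ ih =>
    -- For constant `β` the value `errConst * β ^ 2` is a fixed point of the recursion, so errors do
    -- not accumulate.
    have h1 := integral_gap_outerIter_succ_le S hS (fun _ => hβ) hx₀ τ
    have h2 := mul_le_mul_of_nonneg_left ih (by positivity : 0 ≤ rate γ μ ^ m)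
    have h4 : rate γ μ ^ (m * (τ + 1)) = rate γ μ ^ m * rate γ μ ^ (m * τ) := by
      rw [← pow_add]; ring_nf
    rw [h4]
    linarith

end Outer

/-! ### The number of function evaluations -/

namespace Prog

variable {n d b : ℕ} {α β : Type}

theorem evals_bind (f : Fin n → E d → ℝ) (p : Prog n d α) (q : α → Prog n d β) :
    (p >>= q).evals f = p.evals f + (q (p.run f)).evals f := by
  change (andThen p q).evals f = _
  induction p with
  | ret a => simp [andThen, evals, run]
  | query i x k ih => simp only [andThen, evals, run, ih]; ring

theorem evals_pure (f : Fin n → E d → ℝ) (a : α) : (pure a : Prog n d α).evals f = 0 := rfl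

theorem evals_sumOver {ι : Type} [AddMonoid α] (f : Fin n → E d → ℝ) (l : List ι)
    (p : ι → Prog n d α) {c : ℕ} (hp : ∀ i, (p i).evals f = c) :
    (sumOver l p).evals f = l.length * c := by
  induction l with
  | nil => simp [sumOver, evals]
  | cons a l ih => simp [sumOver, evals_bind, evals_pure, hp, ih]; ring

theorem evals_eval (f : Fin n → E d → ℝ) (i : Fin n) (x : E d) : (eval i x).evals f = 1 := rfl

theorem evals_evalAvg (f : Fin n → E d → ℝ) (x : E d) : (evalAvg x).evals f = n := by
  simp [evalAvg, evals_bind, evals_pure, evals_sumOver f _ _ fun i => evals_eval f i x]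

theorem evals_fullApprox (f : Fin n → E d → ℝ) (β : ℝ) (x : E d) :
    (fullApprox β x).evals f = n * (d + 1) := by
  rw [fullApprox, evals_bind, evals_evalAvg, evals_sumOver f _ _ (c := n) fun j => by
    simp [evals_bind, evals_pure, evals_evalAvg], List.length_finRange]
  ring

theorem length_filter_val_lt {ℓ : ℕ} (hℓd : ℓ ≤ d) :
    ((List.finRange d).filter fun j => j.val < ℓ).length = ℓ := by
  have h := card_filter_val_lt_eq hℓd
  rwa [Finset.card_def, Finset.filter_val] at h

theorem evals_stochApprox (f : Fin n → E d → ℝ) {ℓ : ℕ} (hℓd : ℓ ≤ d) (β : ℝ) (i : Fin n)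
    (G : OGroup d) (x : E d) : (stochApprox ℓ β i G x).evals f = ℓ + 1 := by
  rw [stochApprox, evals_bind, evals_eval, evals_bind, evals_pure,
    evals_sumOver f _ _ (c := 1) fun j => by simp [evals_bind, evals_pure, evals_eval],
    length_filter_val_lt hℓd]
  ring

theorem evals_inner (f : Fin n → E d → ℝ) (h : E d → EReal) (γ : ℝ) {ℓ : ℕ} (hℓd : ℓ ≤ d) (β : ℝ)
    (ξ : ℕ → Fin b → Fin n × OGroup d) (g x₀ : E d) (k : ℕ) :
    (inner h γ ℓ β ξ g x₀ k).evals f = k * (b * (2 * (ℓ + 1))) := by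
  induction k with
  | zero => simp [inner, evals_pure]
  | succ k ih =>
    rw [inner, evals_bind, ih, evals_bind, evals_pure,
      -- Each draw is evaluated afresh at both `x` and `x₀`, with one base value per surrogate.
      evals_sumOver f _ _ (c := 2 * (ℓ + 1)) fun j => by
        simp only [evals_bind, evals_pure, evals_stochApprox f hℓd]; ring, List.length_finRange]
    ring

theorem evals_outerStep (f : Fin n → E d → ℝ) (h : E d → EReal) (γ : ℝ) {ℓ : ℕ} (hℓd : ℓ ≤ d)
    (m : ℕ) (β : ℝ) (ξ : ℕ → Fin b → Fin n × OGroup d) (x₀ : E d) :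
    (outerStep h γ ℓ m β ξ x₀).evals f = n * (d + 1) + m * (b * (2 * (ℓ + 1))) := by
  rw [outerStep, evals_bind, evals_fullApprox, evals_inner f h γ hℓd]

theorem evals_outer (f : Fin n → E d → ℝ) (h : E d → EReal) (γ : ℝ) {ℓ : ℕ} (hℓd : ℓ ≤ d)
    (m : ℕ) (β : ℕ → ℝ) (ξ : ℕ → ℕ → Fin b → Fin n × OGroup d) (x₀ : E d) (τ : ℕ) :
    (outer h γ ℓ m β ξ x₀ τ).evals f = τ * (n * (d + 1) + m * (b * (2 * (ℓ + 1)))) := by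
  induction τ with
  | zero => simp [outer, evals_pure]
  | succ τ ih => rw [outer, evals_bind, ih, evals_outerStep f h γ hℓd]; ring

/-- The exact number of function evaluations of the algorithm. -/
theorem evals_vrszd (f : Fin n → E d → ℝ) (h : E d → EReal) (γ : ℝ) {ℓ : ℕ} (hℓd : ℓ ≤ d)
    (m : ℕ) (β : ℕ → ℝ) (ξ : ℕ → ℕ → Fin b → Fin n × OGroup d) (x₀ : E d) (T : ℕ) :
    (vrszd h γ ℓ m β ξ x₀ T).evals f
      = (T + 1) * (n * (d + 1) + m * (b * (2 * (ℓ + 1)))) := by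
  rw [vrszd, evals_bind, evals_bind, evals_pure, evals_outer f h γ hℓd,
    evals_outerStep f h γ hℓd]
  ring

end Prog

/-! ### The complexity bound -/

section Complexity

/-- The factor in the number of outer iterations that yields accuracy `ε ≤ ε₀` from an initial
gap `D`. -/
noncomputable def iterFactor (D ε₀ : ℝ) : ℝ :=
  2 + 2 * max 0 (Real.log (2 * D) / Real.log (1 / ε₀))

/-- The corresponding factor in the number of function evaluations. -/
noncomputable def evalFactor (D ε₀ : ℝ) : ℝ :=
  4 * (iterFactor D ε₀ + 2 / |Real.log (1 / ε₀)|)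

theorem two_le_iterFactor (D ε₀ : ℝ) : 2 ≤ iterFactor D ε₀ := by
  have := le_max_left 0 (Real.log (2 * D) / Real.log (1 / ε₀))
  rw [iterFactor]; linarith

/-- The absolute value in `evalFactor` gives positivity for every `ε₀`, also outside `(0, 1)`, as
the theorem asks. -/
theorem evalFactor_pos (D ε₀ : ℝ) : 0 < evalFactor D ε₀ := by
  have := two_le_iterFactor D ε₀
  rw [evalFactor]; positivity

theorem log_one_div_pos {ε : ℝ} (hε : 0 < ε) (hε1 : ε < 1) : 0 < Real.log (1 / ε) :=
  Real.log_pos ((one_lt_div hε).2 hε1)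

theorem log_one_div_le {ε₀ ε : ℝ} (hε : 0 < ε) (hle : ε ≤ ε₀) :
    Real.log (1 / ε₀) ≤ Real.log (1 / ε) :=
  Real.log_le_log (one_div_pos.2 (hε.trans_le hle)) (one_div_le_one_div_of_le hε hle)

/-- The exponential decay beats the initial gap. -/
theorem exp_neg_mul_le_half {D ε₀ ε y : ℝ} (hD : 0 ≤ D) (hε₀ : ε₀ < 1) (hε : 0 < ε)
    (hle : ε ≤ ε₀) (hy : iterFactor D ε₀ * Real.log (1 / ε) ≤ 2 * y) :
    Real.exp (-y) * D ≤ ε / 2 := by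
  have hl₀ := log_one_div_pos (hε.trans_le hle) hε₀
  have hl := log_one_div_le hε hle
  -- A zero initial gap is treated apart, since the rest uses `exp (log (2 * D)) = 2 * D`.
  rcases hD.eq_or_lt with rfl | hD
  · rw [mul_zero]; positivity
  set c := max 0 (Real.log (2 * D) / Real.log (1 / ε₀)) with hc
  -- The dependence on `D` is charged to `log (1 / ε)`, which is at least the positive number `log
  -- (1 / ε₀)`.
  have h1 : Real.log (2 * D) ≤ c * Real.log (1 / ε) := by
    calc Real.log (2 * D) = Real.log (2 * D) / Real.log (1 / ε₀) * Real.log (1 / ε₀) := by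
          field_simp
      _ ≤ c * Real.log (1 / ε₀) := by gcongr; exact le_max_right _ _
      _ ≤ c * Real.log (1 / ε) := by gcongr
  have h2 : -y ≤ Real.log ε - Real.log (2 * D) := by
    rw [iterFactor, ← hc] at hy
    have h3 : Real.log (1 / ε) = - Real.log ε := by rw [one_div, Real.log_inv]
    rw [h3] at h1 hy
    linarith
  calc Real.exp (-y) * D ≤ Real.exp (Real.log ε - Real.log (2 * D)) * D := by gcongr
    _ = ε / 2 := by
      rw [Real.exp_sub, Real.exp_log hε, Real.exp_log (by positivity)]
      field_simp

variable {d n b : ℕ} {f : Fin n → E d → ℝ} {h : E d → EReal} {L μ γ : ℝ} {ℓ m : ℕ}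

theorem Setting.mγμ_pos (S : Setting f h L μ γ ℓ m b) : 0 < m * γ * μ := by
  have h1 : (0 : ℝ) < m := by exact_mod_cast S.m_pos
  have h2 := S.γ_pos
  have h3 := S.μ_pos
  positivity

theorem Setting.mγμ_le_one (S : Setting f h L μ γ ℓ m b) : m * γ * μ ≤ 1 := by
  have h1 := S.γμ_lt
  have h2 := mul_pos S.γ_pos S.μ_pos
  linarith

/-- From `1 - x ≤ exp (-x)` the decay is at most `exp (-m γ μ T / 2)`, and the threshold on `T`
makes the exponent large enough. -/
theorem Setting.rate_pow_mul_gap_le (S : Setting f h L μ γ ℓ m b) {D ε₀ ε : ℝ} (hD : 0 ≤ D)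
    (hε₀ : ε₀ < 1) (hε : 0 < ε) (hle : ε ≤ ε₀) {T : ℕ}
    (hT : iterFactor D ε₀ * (1 / (m * γ * μ) * Real.log (1 / ε)) ≤ T) :
    rate γ μ ^ (m * T) * D ≤ ε / 2 := by
  have hpos := S.mγμ_pos
  have h1 : rate γ μ ≤ Real.exp (-(γ * μ / 2)) := by
    have := Real.add_one_le_exp (-(γ * μ / 2))
    rw [rate]; linarith
  have h2 : rate γ μ ^ (m * T) ≤ Real.exp (-(m * γ * μ * T / 2)) := by
    calc _ ≤ Real.exp (-(γ * μ / 2)) ^ (m * T) := by have := S.rate_pos; gcongr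
      _ = _ := by rw [← Real.exp_nat_mul]; push_cast; ring_nf
  refine (mul_le_mul_of_nonneg_right h2 hD).trans
    (exp_neg_mul_le_half hD hε₀ hε hle ?_)
  have h3 := mul_le_mul_of_nonneg_left hT hpos.le
  have h4 : m * γ * μ * (iterFactor D ε₀ * (1 / (m * γ * μ) * Real.log (1 / ε)))
      = iterFactor D ε₀ * Real.log (1 / ε) := by
    rw [one_div, mul_left_comm, mul_inv_cancel_left₀ hpos.ne']
  rw [h4] at h3
  linarith

/-- Rounding up and the extra outer iteration cost at most `2`. Since `m γ μ ≤ 1`, the quantity `X`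
is at least `log (1 / ε₀)`, so a constant multiple of `X` absorbs this. As `d` and `ℓ` are at least
`1`, one outer iteration costs at most `4 (n d + m b ℓ)`. -/
theorem Setting.evals_le (S : Setting f h L μ γ ℓ m b) {D ε₀ ε : ℝ} (hε₀ : ε₀ < 1) (hε : 0 < ε)
    (hle : ε ≤ ε₀) :
    ((⌈iterFactor D ε₀ * (1 / (m * γ * μ) * Real.log (1 / ε))⌉₊ + 1 : ℕ) : ℝ)
        * (n * (d + 1) + m * (b * (2 * (ℓ + 1))))
      ≤ evalFactor D ε₀ * ((n * d / (γ * μ * m) + b * ℓ / (γ * μ)) * Real.log (1 / ε)) := by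
  have hpos := S.mγμ_pos
  have hm : (0 : ℝ) < m := by exact_mod_cast S.m_pos
  have hγ := S.γ_pos
  have hμ := S.μ_pos
  have hℓ : (1 : ℝ) ≤ ℓ := by exact_mod_cast S.one_le_ℓ
  have hd : (1 : ℝ) ≤ d := by exact_mod_cast S.one_le_ℓ.trans S.ℓ_le
  have hl₀ := log_one_div_pos (hε.trans_le hle) hε₀
  have hl := log_one_div_le hε hle
  have hK := two_le_iterFactor D ε₀
  set X := 1 / (m * γ * μ) * Real.log (1 / ε) with hX
  have hX₀ : Real.log (1 / ε₀) ≤ X := by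
    calc _ ≤ 1 * Real.log (1 / ε) := by rw [one_mul]; exact hl
      _ ≤ X := by
        rw [hX]
        gcongr
        · exact hl₀.le.trans hl
        · rw [le_div_iff₀ hpos, one_mul]; exact S.mγμ_le_one
  have hXpos : 0 < X := hl₀.trans_le hX₀
  have hT : ((⌈iterFactor D ε₀ * X⌉₊ + 1 : ℕ) : ℝ)
      ≤ (iterFactor D ε₀ + 2 / |Real.log (1 / ε₀)|) * X := by
    have h1 := (Nat.ceil_lt_add_one (by positivity : 0 ≤ iterFactor D ε₀ * X)).le
    have h2 : 2 ≤ 2 / |Real.log (1 / ε₀)| * X := by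
      rw [abs_of_pos hl₀, div_mul_eq_mul_div, le_div_iff₀ hl₀]
      linarith
    push_cast
    linarith
  have hcost : (n * (d + 1) + m * (b * (2 * (ℓ + 1))) : ℝ) ≤ 4 * (n * d + m * (b * ℓ)) := by
    have h1 : (n * (d + 1) : ℝ) ≤ n * (2 * d) := by gcongr; linarith
    have h2 : (m * (b * (2 * (ℓ + 1))) : ℝ) ≤ m * (b * (4 * ℓ)) := by
      have : (2 * (ℓ + 1) : ℝ) ≤ 4 * ℓ := by linarith
      exact mul_le_mul_of_nonneg_left (mul_le_mul_of_nonneg_left this (by positivity))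
        (by positivity)
    have h3 : (0 : ℝ) ≤ n * d := by positivity
    linarith
  calc _ ≤ (iterFactor D ε₀ + 2 / |Real.log (1 / ε₀)|) * X * (4 * (n * d + m * (b * ℓ))) := by
        gcongr
    _ = _ := by
        rw [evalFactor, hX]
        field_simp

end Complexity

end VRSZD

/-! ### The theorem -/

theorem corollary2 :
    -- `K` and `K'` take the initial gap and an upper bound `ε₀ < 1` on the accuracies
    ∃ K K' : ℝ → ℝ → ℝ, (∀ D ε₀, 0 < K D ε₀ ∧ 0 < K' D ε₀) ∧
    ∀ {d n b : ℕ} {Ω : Type*} [MeasurableSpace Ω] (P : MeasureTheory.Measure Ω)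
      [MeasureTheory.IsProbabilityMeasure P]
      (f : Fin n → VRSZD.E d → ℝ) (h : VRSZD.E d → EReal) (L μ γ : ℝ) (ℓ m : ℕ)
      (I : ℕ → ℕ → Fin b → Ω → Fin n) (G : ℕ → ℕ → Fin b → Ω → VRSZD.OGroup d)
      (x₀ : VRSZD.E d),
      0 < n → 0 < b → 0 < m → 1 ≤ ℓ → ℓ ≤ d → 0 < L → 0 < μ → 0 < γ →
      VRSZD.IsSmoothFamily f L → VRSZD.IsConvexExt h → VRSZD.IsProximable h →
      (∃ z, ∀ x, VRSZD.objective f h z ≤ VRSZD.objective f h x) →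
      VRSZD.IsRPL f h γ μ →
      γ < 1 / (4 * L) → γ < 2 / μ * (1 / (2 * m + 1)) →
      γ < Real.sqrt (b * VRSZD.theta γ μ m) / (10 * m * L) * Real.sqrt (ℓ / d) →
      VRSZD.objective f h x₀ ≠ ⊤ →
      VRSZD.IsSampling P I G →
      -- (i)
      (∀ (η : ℕ → ℝ) (C : ℝ), (∀ τ, 0 < η τ) → Summable (fun τ => η τ ^ 2) →
        ∑' τ, η τ ^ 2 ≤ C → ∀ τ : ℕ,
        VRSZD.ExpectedGapLE P f h
          (fun ω => VRSZD.outerIter f h γ ℓ m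
            (fun t => VRSZD.rate γ μ ^ ((m : ℝ) * (t + 1) / 2) * η t)
            (VRSZD.draws I G ω) x₀ (τ + 1))
          (VRSZD.rate γ μ ^ (m * (τ + 1)) *
            (VRSZD.gap f h x₀ + VRSZD.errConst L μ d ℓ * C))) ∧
      -- (ii)
      (∀ β : ℝ, 0 < β → ∀ τ : ℕ,
        VRSZD.ExpectedGapLE P f h
          (fun ω => VRSZD.outerIter f h γ ℓ m (fun _ => β) (VRSZD.draws I G ω) x₀ (τ + 1))
          (VRSZD.rate γ μ ^ (m * (τ + 1)) * VRSZD.gap f h x₀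
            + VRSZD.errConst L μ d ℓ * β ^ 2)) ∧
      -- (iii)
      (∀ ε₀ ε : ℝ, ε₀ < 1 → 0 < ε → ε ≤ ε₀ →
        (∀ T : ℕ, K (VRSZD.gap f h x₀) ε₀ * (1 / (m * γ * μ) * Real.log (1 / ε)) ≤ T →
          VRSZD.ExpectedGapLE P f h
            (fun ω => (VRSZD.Prog.vrszd h γ ℓ m
              (fun _ => Real.sqrt (ε / (2 * VRSZD.errConst L μ d ℓ)))
              (VRSZD.draws I G ω) x₀ T).run f)
            ε) ∧
        ∀ T : ℕ, T = ⌈K (VRSZD.gap f h x₀) ε₀ * (1 / (m * γ * μ) * Real.log (1 / ε))⌉₊ →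
          ∀ ω, ((VRSZD.Prog.vrszd h γ ℓ m
              (fun _ => Real.sqrt (ε / (2 * VRSZD.errConst L μ d ℓ)))
              (VRSZD.draws I G ω) x₀ T).evals f : ℝ)
            ≤ K' (VRSZD.gap f h x₀) ε₀ *
              ((n * d / (γ * μ * m) + b * ℓ / (γ * μ)) * Real.log (1 / ε))) := by
  refine ⟨VRSZD.iterFactor, VRSZD.evalFactor, fun D ε₀ =>
    ⟨two_pos.trans_le (VRSZD.two_le_iterFactor D ε₀), VRSZD.evalFactor_pos D ε₀⟩, ?_⟩
  intro d n b Ω _ P _ f h L μ γ ℓ m I G x₀ hn hb hm hℓ hℓd hL hμ hγ hf hconv hprox hmin hrpl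
    hγ₁ hγ₂ hγ₃ hF₀ hS
  have S : VRSZD.Setting f h L μ γ ℓ m b :=
    ⟨hn, hb, hm, hℓ, hℓd, hL, hμ, hγ, hf, hconv, hprox, hmin, hrpl, hγ₁, hγ₂, hγ₃⟩
  have hx₀ : h x₀ ≠ ⊤ := VRSZD.objective_ne_top_iff.1 hF₀
  have hα := S.rate_pos
  have hE := VRSZD.errConst_pos S
  refine ⟨fun η C hη hsum hC τ => ?_, fun β hβ τ => ?_, fun ε₀ ε hε₀ hε hle =>
    ⟨fun T hT => ?_, fun T hT ω => ?_⟩⟩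
  · have hβ : ∀ t : ℕ, 0 < VRSZD.rate γ μ ^ ((m : ℝ) * (t + 1) / 2) * η t := fun t =>
      mul_pos (Real.rpow_pos_of_pos hα _) (hη t)
    refine VRSZD.expectedGapLE_outerIter S hS hβ hx₀ (τ + 1)
      ((VRSZD.integral_gap_le_of_geometric S hS hβ hx₀ (η := η) (fun t => ?_) (τ + 1)).trans ?_)
    -- Squaring removes the half in the exponent, so the real power becomes a natural one.
    · have hexp : (m : ℝ) * (t + 1) / 2 * (2 : ℕ) = (m * (t + 1) : ℕ) := by push_cast; ring
      rw [mul_pow, ← Real.rpow_mul_natCast hα.le, hexp, Real.rpow_natCast]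
    · gcongr
      exact (hsum.sum_le_tsum _ fun t _ => sq_nonneg (η t)).trans hC
  · exact VRSZD.expectedGapLE_outerIter S hS (fun _ => hβ) hx₀ (τ + 1)
      (VRSZD.integral_gap_le_of_const S hS hβ hx₀ (τ + 1))
  · simp only [VRSZD.Prog.run_vrszd]
    have hβ : 0 < Real.sqrt (ε / (2 * VRSZD.errConst L μ d ℓ)) := by positivity
    refine VRSZD.expectedGapLE_outerIter S hS (fun _ => hβ) hx₀ T
      ((VRSZD.integral_gap_le_of_const S hS hβ hx₀ T).trans ?_)
    have h1 := S.rate_pow_mul_gap_le (S.gap_nonneg hx₀) hε₀ hε hle hT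
    -- The chosen `β` makes the discretization error exactly `ε / 2`; `T` controls the other half.
    have h2 : VRSZD.errConst L μ d ℓ * Real.sqrt (ε / (2 * VRSZD.errConst L μ d ℓ)) ^ 2
        = ε / 2 := by
      rw [Real.sq_sqrt (by positivity)]; field_simp
    linarith
  · rw [VRSZD.Prog.evals_vrszd f h γ hℓd, hT]
    have h1 := S.evals_le (D := VRSZD.gap f h x₀) hε₀ hε hle
    push_cast at h1 ⊢
    exact h1
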